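/- **Setting.** Let $[u]=\{1,\dots,u\}$. A stream is a sequence $x^1,x^2,\dots$ of updates of a set $D\subseteq[u]$, initially empty; $D_t$ is the set after the first $t$ updates. In the *fully dynamic* (turnstile) problem every update inserts an element of $[u]$, deletes an element, or does nothing; in the *partially dynamic* problem every update inserts an element or does nothing. (Inserting a present or deleting an absent element has no effect.) Two streams are neighbouring if they differ in the update of at most one time step. An algorithm is a randomized online algorithm with inputs $u$, $\epsilon$, $\beta$ that does not know the length of the stream: after every time step $t$ it outputs, for every query $q\in[u]$, an answer $x_{t,q}\in[u]\cup\{\bot\}$, depending only on its random coins and on $x^1,\dots,x^t$. It is $\epsilon$-differentially private if for every $T$, all neighbouring streams and every set $S$ of output sequences of length $T$, the probability that the first $T$ outputs lie in $S$ changes by a factor of at most $e^\epsilon$. It solves the relaxed predecessor problem with error $\alpha_t$ and failure probability $\beta$ if on every stream, with probability at least $1-\beta$, for all $t\ge 1$ and all $q\in[u]$ simultaneously: either $x_{t,q}\in[u]$ and $1\le |D_t\cap[x_{t,q},q]|\le\alpha_t$, or $x_{t,q}=\bot$ and $|D_t\cap[1,q]|\le\alpha_t$. **Theorem.** 1. There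 is an algorithm for the fully dynamic relaxed predecessor problem that, for all $u\ge1$, $\epsilon>0$ and $0<\beta<1$, is $\epsilon$-differentially private and has, with failure probability $\beta$, an error $\alpha_t=\alpha_t(u,\epsilon,\beta)$, nondecreasing in $t$, such that $$\alpha_t=O\bigl(\epsilon^{-1}(\log u\,\log t)^{3/2}\sqrt{\log(ut/\beta)}\bigr)\qquad\text{whenever } \epsilon=O(1)\text{ and }\log(1/\beta)=O(\log u\,\log t).$$ That is, for all $\epsilon_0,K$ there is a $C$ such that $\alpha_t\le C\epsilon^{-1}(\log u\log t)^{3/2}\sqrt{\log(ut/\beta)}$ for all $u\ge2$, $t\ge2$, $0<\epsilon\le\epsilon_0$ and $0<\beta<1$ with $\log(1/\beta)\le K\log u\log t$. 2. There is an algorithm for the partially dynamic relaxed predecessor problem that, for all $u\ge1$, $\epsilon>0$ and $0<\beta<1$, is $\epsilon$-differentially private and has, with failure probability $\beta$, an error $\alpha_t=\alpha_t(u,\epsilon,\beta)$, nondecreasing in $t$, such that $$\alpha_t=O\bigl((1+\epsilon^{-1})\log u\,\log(u/\beta)\sqrt{\log(t/\beta)}\bigr)\qquad\text{whenever } t=O(u).$$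 That is, for every $A$ there is a $C$ such that $\alpha_t\le C(1+\epsilon^{-1})\log u\log(u/\beta)\sqrt{\log(t/\beta)}$ for all $u\ge2$, $\epsilon>0$, $0<\beta<1$ and $2\le t\le Au$. -/

import Mathlib

/-- The update at one time step of a fully dynamic stream over an ordered universe of `u` elements
(modelled by `Fin u`): insert an element, delete an element, or leave the data set unchanged. -/
inductive FullUpdate (u : ℕ) : Type
  | insert (x : Fin u) : FullUpdate u
  | delete (x : Fin u) : FullUpdate u
  | idle : FullUpdate u

/-- The update at one time step of a partially dynamic (insertions only) stream: insert an element
or leave the data set unchanged. -/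
inductive InsertUpdate (u : ℕ) : Type
  | insert (x : Fin u) : InsertUpdate u
  | idle : InsertUpdate u

/-- Effect of an update on the data set. The data set is a set: inserting a present element and
deleting an absent one have no effect. -/
def FullUpdate.step {u : ℕ} (D : Finset (Fin u)) : FullUpdate u → Finset (Fin u)
  | .insert x => Insert.insert x D
  | .delete x => D.erase x
  | .idle => D

/-- Effect of an insertion-only update on the data set. -/
def InsertUpdate.step {u : ℕ} (D : Finset (Fin u)) : InsertUpdate u → Finset (Fin u)
  | .insert x => Insert.insert x D
  | .idle => D

/-- The data set after the first `t` updates of the stream `x`, starting from the empty set.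
The update of time step `t` (for `t = 1, 2, …`) is `x (t - 1)`. -/
def dataSet {X : Type} {u : ℕ} (step : Finset (Fin u) → X → Finset (Fin u)) (x : ℕ → X) :
    ℕ → Finset (Fin u)
  | 0 => ∅
  | t + 1 => step (dataSet step x t) (x t)

/-- The list of the updates of the time steps `1, …, t`. -/
def streamPrefix {X : Type} (x : ℕ → X) (t : ℕ) : List X := (List.range t).map x

/-- Event-level neighbouring streams: they differ in the operation of at most one time step. -/
def Neighboring {X : Type} (x y : ℕ → X) : Prop := ∃ s, ∀ i, i ≠ s → x i = y i

/-- A randomized algorithm under continual observation, with no bound on the length of the stream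
known in advance. With its random coins `ω` drawn from `P`, after each time step it answers every
query `q : Fin u` by an element of the universe or by `none` (for `⊥`); the answers of time step `t`
depend on the coins and the updates of the time steps `1, …, t` only. -/
structure PredMechanism (X : Type) (u : ℕ) where
  /-- the sample space of the random coins -/
  Ω : Type
  /-- the events -/
  mΩ : MeasurableSpace Ω
  /-- the law of the random coins -/
  P : MeasureTheory.Measure Ω
  isProb : MeasureTheory.IsProbabilityMeasure P
  /-- the answers to all queries, given the updates so far and the coins -/
  out : List X → Ω → Fin u → Option (Fin u)
  measurable_out : ∀ (l : List X) (S : Set (Fin u → Option (Fin u))), MeasurableSet (out l ⁻¹' S)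

/-- The sequence of the outputs of the time steps `1, …, T` on the stream `x`. -/
def PredMechanism.transcript {X : Type} {u : ℕ} (M : PredMechanism X u) (x : ℕ → X) (T : ℕ)
    (ω : M.Ω) : Fin T → Fin u → Option (Fin u) :=
  fun i => M.out (streamPrefix x (i + 1)) ω

/-- `ε`-differential privacy of the whole sequence of outputs, for every stream length `T`. -/
def PredMechanism.IsDP {X : Type} {u : ℕ} (M : PredMechanism X u) (ε : ℝ) : Prop :=
  ∀ x y : ℕ → X, Neighboring x y → ∀ (T : ℕ) (S : Set (Fin T → Fin u → Option (Fin u))),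
    M.P {ω | M.transcript x T ω ∈ S} ≤
      ENNReal.ofReal (Real.exp ε) * M.P {ω | M.transcript y T ω ∈ S}

/-- `IsRelaxedPred D a q r`: the answer `r` to the query `q` on the data set `D` is correct with
additive error `a`. -/
def IsRelaxedPred {u : ℕ} (D : Finset (Fin u)) (a : ℝ) (q : Fin u) : Option (Fin u) → Prop
  | some x => 1 ≤ (D ∩ Finset.Icc x q).card ∧ ((D ∩ Finset.Icc x q).card : ℝ) ≤ a
  | none => ((D ∩ Finset.Iic q).card : ℝ) ≤ a

/-- On every stream, with probability at least `1 - β`, at all time steps `t ≥ 1` simultaneously,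
all queries are answered correctly with additive error `α t`. -/
def PredMechanism.Solves {X : Type} {u : ℕ} (M : PredMechanism X u)
    (step : Finset (Fin u) → X → Finset (Fin u)) (α : ℕ → ℝ) (β : ℝ) : Prop :=
  ∀ x : ℕ → X, ENNReal.ofReal (1 - β) ≤
    M.P {ω | ∀ t : ℕ, 1 ≤ t → ∀ q : Fin u,
      IsRelaxedPred (dataSet step x t) (α t) q (M.out (streamPrefix x t) ω q)}

/-!
Both mechanisms draw one independent discrete Laplace variable per counter, threshold or test, on
the sample space `ι → ℤ` with a product law. Privacy is shown by shifting the noise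
(`lapNoise_shift`): if every result of a run on one stream is also reached on the neighbouring
stream once the noise is shifted by a vector of small weighted length, then no result becomes much
more likely. Accuracy comes from a Chernoff bound for sums of such variables (`lapNoise_sum_tail`)
and a union bound.

*Fully dynamic streams.* The net changes of the data set are counted in all products of a dyadic
time interval and a dyadic interval of the universe. The number of elements below `m` at time `t` is
a sum of `O(log u * log t)` such counters (`prefixEst_eq`), and prefix counts up to an error `E`
yield relaxed predecessors with error `4 * E + 1` (`isRelaxedPred_predAnswer`). As the length of the
stream is unknown, only time intervals which avoid `0` are used: a time `τ` lies in just
`Nat.log 2 τ + 1` of them, and the noise of an interval within `[2 ^ k, 2 ^ (k + 1))` has a scale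
proportional to `k + 1`. Changing one update changes the stream of insertions into and deletions
from the data set by at most four in total (`sum_sum_memDiff_le`), which bounds the privacy loss.

*Partially dynamic streams.* The binary tree over the universe is explored adaptively: an insertion
is counted at a single node, the highest unmarked one above the inserted element, and a node is
marked once its count passes a noisy threshold. Since an insertion is counted at one node only, it
suffices to run the sparse vector technique at each node with noise of scale `O(1 / ε)`, whatever the
depth of the tree: given the history of the marks, a changed insertion is made up for by shifting the
threshold of the node by one and its successful test by two (`marks_shift`). A marked node contains
an element of the data set. If no marked node lies within `[a, q]`, then the elements of `[a, q]`
were counted at children of the two boundary paths of the interval, hence at `O(log u)` nodes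
(`hits_mem_boundary`), each with a count of order `(1 + ε⁻¹) * log (u * t / β)`. The resulting error
`O((1 + ε⁻¹) * log u * log (u * t / β))` is within the required bound when `t = O(u)`.
-/

open MeasureTheory ProbabilityTheory

/-! ### Discrete Laplace noise -/

theorem hasSum_geom_int {r E F : ℝ} (hE : 0 < E) (hF : 0 < F) (hEF : E * F = 1) (hr : 0 ≤ r)
    (h1 : r * E < 1) (h2 : r * F < 1) :
    HasSum (fun k : ℤ => r ^ k.natAbs * E ^ k) ((1 - r ^ 2) / ((1 - r * E) * (1 - r * F))) := by
  have a := hasSum_geometric_of_lt_one (mul_nonneg hr hE.le) h1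
  have b := (hasSum_geometric_of_lt_one (mul_nonneg hr hF.le) h2).mul_left (r * F)
  have h := HasSum.of_nat_of_neg_add_one (f := fun k : ℤ => r ^ k.natAbs * E ^ k)
    (m := (1 - r * E)⁻¹) (m' := r * F * (1 - r * F)⁻¹) (by simpa [mul_pow] using a) (by
      have e : (fun n : ℕ => r ^ (-((n : ℤ) + 1)).natAbs * E ^ (-((n : ℤ) + 1))) =
          fun n => r * F * (r * F) ^ n := by
        funext n
        have h1 : (-((n : ℤ) + 1)).natAbs = n + 1 := by omega
        have h2 : F = E⁻¹ := eq_inv_of_mul_eq_one_right hEF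
        have h3 : E ^ (-((n : ℤ) + 1)) = F ^ (n + 1) := by
          rw [zpow_neg, h2, inv_pow]; norm_cast
        rw [h1, h3, ← mul_pow, pow_succ']
      rwa [e])
  have e : (1 - r ^ 2) / ((1 - r * E) * (1 - r * F)) =
      (1 - r * E)⁻¹ + r * F * (1 - r * F)⁻¹ := by
    have : (1 - r * E) ≠ 0 := by linarith
    have : (1 - r * F) ≠ 0 := by linarith
    field_simp
    linear_combination r ^ 2 * hEF
  rwa [e]

/-- Convexity of `sinh` on the half-line, read off from its power series. -/
theorem sinh_mul_le {θ x : ℝ} (h0 : 0 ≤ θ) (h1 : θ ≤ 1) (hx : 0 ≤ x) :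
    Real.sinh (θ * x) ≤ θ * Real.sinh x := by
  refine hasSum_le (fun n => ?_) (Real.hasSum_sinh (θ * x)) ((Real.hasSum_sinh x).mul_left θ)
  rw [mul_pow, mul_div_assoc]
  gcongr
  calc θ ^ (2 * n + 1) ≤ θ ^ 1 := pow_le_pow_of_le_one h0 h1 (by omega)
    _ = θ := pow_one θ

/-- The mass at `k` of the discrete Laplace distribution with rate `a`. -/
noncomputable def lapMass (a : ℝ) (k : ℤ) : ℝ :=
  (1 - Real.exp (-a)) / (1 + Real.exp (-a)) * Real.exp (-a) ^ k.natAbs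

theorem lapMass_nonneg {a : ℝ} (ha : 0 < a) (k : ℤ) : 0 ≤ lapMass a k := by
  have : Real.exp (-a) < 1 := by simpa using ha
  unfold lapMass
  have := Real.exp_pos (-a)
  have : 0 < 1 - Real.exp (-a) := by linarith
  positivity

/-- The moment generating function of the discrete Laplace distribution. -/
theorem hasSum_lapMass_mul_exp {a l : ℝ} (h : |l| < a) :
    HasSum (fun k : ℤ => lapMass a k * Real.exp (l * k))
      ((1 - Real.exp (-a)) ^ 2 / ((1 - Real.exp (-a) * Real.exp l) *
        (1 - Real.exp (-a) * Real.exp (-l)))) := by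
  obtain ⟨h1, h2⟩ := abs_lt.mp h
  have hr0 := Real.exp_pos (-a)
  have e1 : Real.exp (-a) * Real.exp l < 1 := by
    rw [← Real.exp_add, Real.exp_lt_one_iff]; linarith
  have e2 : Real.exp (-a) * Real.exp (-l) < 1 := by
    rw [← Real.exp_add, Real.exp_lt_one_iff]; linarith
  have := (hasSum_geom_int (Real.exp_pos l) (Real.exp_pos (-l)) (by simp [← Real.exp_add]) hr0.le e1
    e2).mul_left ((1 - Real.exp (-a)) / (1 + Real.exp (-a)))
  have e1 : (fun k : ℤ => lapMass a k * Real.exp (l * k)) = fun k : ℤ =>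
      (1 - Real.exp (-a)) / (1 + Real.exp (-a)) * (Real.exp (-a) ^ k.natAbs * Real.exp l ^ k) := by
    funext k
    rw [lapMass, mul_assoc, ← Real.rpow_intCast, ← Real.exp_mul]
  have h1 : 1 + Real.exp (-a) ≠ 0 := by positivity
  rw [e1]
  have e2 : ∀ d : ℝ, (1 - Real.exp (-a)) ^ 2 / d =
      (1 - Real.exp (-a)) / (1 + Real.exp (-a)) * ((1 - Real.exp (-a) ^ 2) / d) := by
    intro d
    rw [← mul_div_assoc]
    congr 1
    field_simp
    ring
  rwa [e2]

theorem hasSum_lapMass {a : ℝ} (ha : 0 < a) : HasSum (lapMass a) 1 := by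
  have h := hasSum_lapMass_mul_exp (a := a) (l := 0) (by simpa using ha)
  have : 1 - Real.exp (-a) ≠ 0 := by
    have : Real.exp (-a) < 1 := by simpa using ha
    linarith
  simp only [zero_mul, Real.exp_zero, mul_one, neg_zero] at h
  rwa [← sq, div_self (by positivity)] at h

/-- The moment generating function is at most that of a Gaussian variable with standard deviation
`2 / a`, as long as the argument stays away from its pole at `a`. -/
theorem lapMass_mgf_le {a l : ℝ} (ha : 0 < a) (h : |l| ≤ a / 2) :
    (1 - Real.exp (-a)) ^ 2 / ((1 - Real.exp (-a) * Real.exp l) *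
        (1 - Real.exp (-a) * Real.exp (-l))) ≤ Real.exp (2 * (l / a) ^ 2) := by
  set s := (l / a) ^ 2 with hs
  have hθ : |l| / a ≤ 1 / 2 := by rw [div_le_iff₀ ha]; linarith
  have hθ0 : 0 ≤ |l| / a := by positivity
  have hs4 : s ≤ 1 / 4 := by
    have : s = (|l| / a) ^ 2 := by rw [hs, div_pow, div_pow, sq_abs]
    rw [this]; nlinarith
  have hs0 : 0 ≤ s := sq_nonneg _
  have hr0 := Real.exp_pos (-a)
  have hr1 : Real.exp (-a) < 1 := by simpa using ha
  -- The comparison `cosh l - 1 ≤ (l / a) ^ 2 * (cosh a - 1)`, through half arguments.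
  have key : Real.exp (-a) * (Real.exp l + Real.exp (-l) - 2) ≤ s * (1 - Real.exp (-a)) ^ 2 := by
    have h1 := sinh_mul_le hθ0 (by linarith) (x := a / 2) (by linarith)
    have h2 : |l| / a * (a / 2) = |l| / 2 := by field_simp
    rw [h2] at h1
    have h3 : 0 ≤ Real.sinh (|l| / 2) := Real.sinh_nonneg_iff.mpr (by positivity)
    have h4 : Real.sinh (|l| / 2) ^ 2 ≤ s * Real.sinh (a / 2) ^ 2 := by
      calc _ ≤ (|l| / a * Real.sinh (a / 2)) ^ 2 := pow_le_pow_left₀ h3 h1 2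
        _ = _ := by rw [mul_pow, hs, div_pow, div_pow, sq_abs]
    have h5 : ∀ y : ℝ, 4 * Real.sinh (y / 2) ^ 2 = Real.exp y + Real.exp (-y) - 2 := by
      intro y
      rw [Real.sinh_eq]
      have e1 : Real.exp y = Real.exp (y / 2) ^ 2 := by rw [← Real.exp_nat_mul]; ring_nf
      have e2 : Real.exp (-y) = Real.exp (-(y / 2)) ^ 2 := by rw [← Real.exp_nat_mul]; ring_nf
      have e3 : Real.exp (y / 2) * Real.exp (-(y / 2)) = 1 := by rw [← Real.exp_add]; simp
      rw [e1, e2]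
      linear_combination (-2) * e3
    have h6 : Real.exp |l| + Real.exp (-|l|) = Real.exp l + Real.exp (-l) := by
      rcases abs_choice l with h | h <;> rw [h]
      rw [neg_neg, add_comm]
    have h7 : Real.exp (-a) * Real.exp a = 1 := by rw [← Real.exp_add]; simp
    have h8 : Real.exp (-a) * (4 * Real.sinh (a / 2) ^ 2) = (1 - Real.exp (-a)) ^ 2 := by
      rw [h5]; linear_combination h7
    have h9 := h5 |l|
    rw [h6] at h9
    rw [← h9, ← h8]
    nlinarith [mul_le_mul_of_nonneg_left h4 hr0.le]
  have hEF : Real.exp l * Real.exp (-l) = 1 := by simp [← Real.exp_add]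
  have hden : (1 - Real.exp (-a)) ^ 2 * (1 - s) ≤
      (1 - Real.exp (-a) * Real.exp l) * (1 - Real.exp (-a) * Real.exp (-l)) := by
    have : (1 - Real.exp (-a) * Real.exp l) * (1 - Real.exp (-a) * Real.exp (-l)) =
      (1 - Real.exp (-a)) ^ 2 - Real.exp (-a) * (Real.exp l + Real.exp (-l) - 2) := by
      linear_combination Real.exp (-a) ^ 2 * hEF
    rw [this]; linarith
  have hpos : 0 < (1 - Real.exp (-a)) ^ 2 := by
    have : 0 < 1 - Real.exp (-a) := by linarith
    positivity
  have hpos2 : 0 < (1 - Real.exp (-a)) ^ 2 * (1 - s) := mul_pos hpos (by linarith)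
  rw [div_le_iff₀ (hpos2.trans_le hden)]
  have he := Real.add_one_le_exp (2 * s)
  calc (1 - Real.exp (-a)) ^ 2 ≤ (2 * s + 1) * ((1 - Real.exp (-a)) ^ 2 * (1 - s)) := by
        nlinarith [mul_nonneg hpos.le (mul_nonneg hs0 (by linarith : 0 ≤ 1 - 2 * s))]
    _ ≤ Real.exp (2 * s) * _ := by gcongr

/-- The discrete Laplace distribution on `ℤ` with rate `a` (that is, scale `1 / a`); for `a ≤ 0`,
where the masses do not sum to one, the point mass at `0`. -/
noncomputable def lapPMF (a : ℝ) : PMF ℤ :=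
  open Classical in
  ⟨fun k => if 0 < a then ENNReal.ofReal (lapMass a k) else PMF.pure 0 k, by
    by_cases ha : 0 < a
    · have h := ENNReal.ofReal_tsum_of_nonneg (lapMass_nonneg ha) (hasSum_lapMass ha).summable
      rw [(hasSum_lapMass ha).tsum_eq, ENNReal.ofReal_one] at h
      simp only [ha, if_true]
      rw [h]
      exact ENNReal.summable.hasSum
    · simp only [ha, if_false]
      exact (PMF.pure (0 : ℤ)).2⟩

theorem lapPMF_apply {a : ℝ} (ha : 0 < a) (k : ℤ) :
    lapPMF a k = ENNReal.ofReal (lapMass a k) :=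
  if_pos ha

/-- Shifting by `c` changes the masses by a factor of at most `exp (a * |c|)`. -/
theorem lapPMF_le_shift {a : ℝ} (ha : 0 < a) (k c : ℤ) :
    lapPMF a k ≤ ENNReal.ofReal (Real.exp (a * |c|)) * lapPMF a (k + c) := by
  rw [lapPMF_apply ha, lapPMF_apply ha, ← ENNReal.ofReal_mul (Real.exp_pos _).le]
  apply ENNReal.ofReal_le_ofReal
  have hr1 : Real.exp (-a) < 1 := by simpa using ha
  have hr0 := Real.exp_pos (-a)
  unfold lapMass
  rw [mul_left_comm]
  have : 0 < 1 - Real.exp (-a) := by linarith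
  gcongr
  rw [← Real.exp_nat_mul, ← Real.exp_nat_mul, ← Real.exp_add]
  gcongr
  have h1 : ((k + c).natAbs : ℝ) ≤ k.natAbs + |c| := by
    rw [Nat.cast_natAbs, Nat.cast_natAbs]
    exact_mod_cast abs_add_le k c
  nlinarith

theorem integrable_exp_lap {a l : ℝ} (ha : 0 < a) (h : |l| < a) :
    Integrable (fun k : ℤ => Real.exp (l * k)) (lapPMF a).toMeasure := by
  refine ⟨(measurable_of_countable _).aestronglyMeasurable, ?_⟩
  rw [HasFiniteIntegral, lintegral_countable']
  have : ∀ k : ℤ, ‖Real.exp (l * k)‖ₑ * (lapPMF a).toMeasure {k} =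
      ENNReal.ofReal (lapMass a k * Real.exp (l * k)) := by
    intro k
    rw [PMF.toMeasure_apply_singleton _ _ (MeasurableSet.singleton _), lapPMF_apply ha, mul_comm,
      Real.enorm_eq_ofReal (Real.exp_pos _).le, ← ENNReal.ofReal_mul (lapMass_nonneg ha k)]
  simp_rw [this]
  exact (hasSum_lapMass_mul_exp h).summable.tsum_ofReal_lt_top

theorem mgf_lap_le {a l : ℝ} (ha : 0 < a) (h : |l| ≤ a / 2) :
    ∫ k : ℤ, Real.exp (l * k) ∂(lapPMF a).toMeasure ≤ Real.exp (2 * (l / a) ^ 2) := by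
  have h' : |l| < a := by linarith
  rw [PMF.integral_eq_tsum _ _ (integrable_exp_lap ha h')]
  have : ∀ k : ℤ, (lapPMF a k).toReal • Real.exp (l * k) = lapMass a k * Real.exp (l * k) := by
    intro k
    rw [lapPMF_apply ha, ENNReal.toReal_ofReal (lapMass_nonneg ha k), smul_eq_mul]
  simp_rw [this]
  rw [(hasSum_lapMass_mul_exp h').tsum_eq]
  exact lapMass_mgf_le ha h

/-- The law of independent discrete Laplace variables, the one at `n` having rate `a n`. -/
noncomputable abbrev lapNoise {ι : Type} (a : ι → ℝ) : Measure (ι → ℤ) :=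
  Measure.infinitePi fun n => (lapPMF (a n)).toMeasure

/-- One-sided tail of a signed sum of independent discrete Laplace variables; `c = ± 1`. -/
theorem lapNoise_sum_tail_aux {ι : Type} {a : ι → ℝ} (ha : ∀ n, 0 < a n) (S : Finset ι) {b N l : ℝ}
    (hb : 0 < b) (hS : ∀ n ∈ S, b ≤ a n) (hN : (S.card : ℝ) ≤ N) (hl : 0 < l) (c : ℝ)
    (hc : |c| = 1) :
    (lapNoise a).real {ω | 3 / b * √((N + l) * l) ≤ ∑ n ∈ S, c * (ω n : ℝ)} ≤ Real.exp (-l) := by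
  have hN0 : 0 ≤ N := (Nat.cast_nonneg _).trans hN
  -- This Chernoff parameter is at most `b / 2`, where the bound for the moment generating functions
  -- holds, and makes the exponent at most `l / 2 - 3 * l / 2 = -l`.
  set t : ℝ := b / 2 * √(l / (N + l)) with ht
  have ht0 : 0 ≤ t := by positivity
  have hq : l / (N + l) ≤ 1 := by rw [div_le_one (by linarith)]; linarith
  have htb : t ≤ b / 2 := by
    have : √(l / (N + l)) ≤ 1 := Real.sqrt_le_one.mpr hq
    nlinarith
  have hta : ∀ n ∈ S, |t * c| ≤ a n / 2 := by
    intro n hn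
    rw [abs_mul, hc, mul_one, abs_of_nonneg ht0]
    linarith [hS n hn]
  let X : ι → (ι → ℤ) → ℝ := fun n ω => c * (ω n : ℝ)
  have hmeas : ∀ n, Measurable (X n) := fun n =>
    (measurable_of_countable (fun k : ℤ => c * (k : ℝ))).comp (measurable_pi_apply n)
  have hind : iIndepFun X (lapNoise a) :=
    iIndepFun_infinitePi (X := fun _ (k : ℤ) => c * (k : ℝ)) fun _ => measurable_of_countable _
  have hint : ∀ n ∈ S, Integrable (fun ω => Real.exp (t * X n ω)) (lapNoise a) := by
    intro n hn
    have h := integrable_exp_lap (ha n) (l := t * c) (by linarith [hta n hn, ha n])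
    have hp := measurePreserving_eval_infinitePi (fun n => (lapPMF (a n)).toMeasure) n
    have := hp.integrable_comp_of_integrable h
    refine this.congr (Filter.Eventually.of_forall fun ω => ?_)
    simp [X, mul_assoc]
  have hmgf : ∀ n ∈ S, mgf (X n) (lapNoise a) t ≤ Real.exp (2 * (t / b) ^ 2) := by
    intro n hn
    have h := mgf_lap_le (ha n) (hta n hn)
    have e : mgf (X n) (lapNoise a) t = ∫ k : ℤ, Real.exp (t * c * k) ∂(lapPMF (a n)).toMeasure := by
      have hp := measurePreserving_eval_infinitePi (fun n => (lapPMF (a n)).toMeasure) n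
      rw [← hp.map_eq, integral_map hp.measurable.aemeasurable
        (measurable_of_countable _).aestronglyMeasurable]
      simp [mgf, X, mul_assoc]
    rw [e]
    refine h.trans ?_
    have h1 : (t * c / a n) ^ 2 = (t / a n) ^ 2 := by
      rw [mul_div_right_comm, mul_pow, ← sq_abs c, hc, one_pow, mul_one]
    have := hS n hn
    have := ha n
    rw [h1]
    gcongr
  have h := measure_ge_le_exp_mul_mgf (μ := lapNoise a) (X := ∑ n ∈ S, X n) (t := t)
    (3 / b * √((N + l) * l)) ht0 (hind.integrable_exp_mul_sum hmeas hint)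
  rw [hind.mgf_sum hmeas] at h
  have hprod : ∏ n ∈ S, mgf (X n) (lapNoise a) t ≤ Real.exp (2 * (t / b) ^ 2) ^ S.card := by
    refine (Finset.prod_le_prod (fun n hn => mgf_nonneg) hmgf).trans ?_
    rw [Finset.prod_const]
  have e1 : {ω : ι → ℤ | 3 / b * √((N + l) * l) ≤ ∑ n ∈ S, c * (ω n : ℝ)} =
      {ω | 3 / b * √((N + l) * l) ≤ (∑ n ∈ S, X n) ω} := by
    simp [X, Finset.sum_apply]
  rw [e1]
  refine h.trans ((mul_le_mul_of_nonneg_left hprod (Real.exp_pos _).le).trans ?_)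
  rw [← Real.exp_nat_mul, ← Real.exp_add, Real.exp_le_exp]
  have h2 : (t / b) ^ 2 = l / (N + l) / 4 := by
    rw [ht, mul_div_right_comm, mul_pow, Real.sq_sqrt (by positivity)]
    field_simp
    norm_num
  have h3 : t * (3 / b * √((N + l) * l)) = 3 / 2 * l := by
    have : √(l / (N + l)) * √((N + l) * l) = l := by
      rw [← Real.sqrt_mul (by positivity)]
      have : l / (N + l) * ((N + l) * l) = l * l := by field_simp
      rw [this, Real.sqrt_mul_self hl.le]
    rw [ht]
    calc _ = 3 / 2 * (b / b) * (√(l / (N + l)) * √((N + l) * l)) := by ring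
      _ = _ := by rw [this, div_self hb.ne']; ring
  have h4 : (S.card : ℝ) * (2 * (t / b) ^ 2) ≤ l / 2 := by
    rw [h2]
    have : (S.card : ℝ) * (l / (N + l)) ≤ l := by
      rw [mul_div_assoc', div_le_iff₀ (by linarith)]
      nlinarith
    linarith
  linarith [neg_mul t (3 / b * √((N + l) * l))]

/-- Deviation of a sum of at most `N` independent discrete Laplace variables of scale at most
`1 / b`. For `l ≤ N` the bound is of order `b⁻¹ * √(N * l)`, as for Gaussian variables. -/
theorem lapNoise_sum_tail {ι : Type} {a : ι → ℝ} (ha : ∀ n, 0 < a n) (S : Finset ι) {b N l : ℝ}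
    (hb : 0 < b) (hS : ∀ n ∈ S, b ≤ a n) (hN : (S.card : ℝ) ≤ N) (hl : 0 < l) :
    lapNoise a {ω | 3 / b * √((N + l) * l) ≤ |∑ n ∈ S, (ω n : ℝ)|} ≤
      ENNReal.ofReal (2 * Real.exp (-l)) := by
  have h1 := lapNoise_sum_tail_aux ha S hb hS hN hl 1 (by simp)
  have h2 := lapNoise_sum_tail_aux ha S hb hS hN hl (-1) (by simp)
  rw [← ENNReal.ofReal_toReal (measure_ne_top (lapNoise a) _)]
  apply ENNReal.ofReal_le_ofReal
  change (lapNoise a).real _ ≤ _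
  refine (measureReal_mono (s₂ := _ ∪ _) ?_).trans
    ((measureReal_union_le _ _).trans ((add_le_add h1 h2).trans_eq (two_mul _).symm))
  intro ω hω
  rcases le_abs.mp (Set.mem_ofPred.mp hω) with h | h
  · left; simpa using h
  · right; simpa using h

/-! ### Privacy by shifting the noise -/

theorem measurableSet_of_dependsOn {ι Γ : Type} {J : Finset ι} {F : (ι → ℤ) → Γ}
    (hF : DependsOn F J) (S : Set Γ) : MeasurableSet (F ⁻¹' S) := by
  have : F ⁻¹' S = J.restrict ⁻¹' (J.restrict '' (F ⁻¹' S) : Set (J → ℤ)) := by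
    refine (Set.subset_preimage_image _ _).antisymm ?_
    rintro ω ⟨ω', h', h⟩
    have : F ω' = F ω := hF fun n hn => congrFun h ⟨n, hn⟩
    rwa [Set.mem_preimage, ← this]
  rw [this]
  exact Finset.measurable_restrict J (Set.to_countable _).measurableSet

/-- If shifting the noise by some vector `c`, of weighted length `∑ a n * |c n|` at most `ε`, turns
the runs of `F` with result `g` into runs of `G` with result `g`, then `g` is at most `exp ε` times
as likely under `F` as under `G`. Only finitely many noise variables may matter. -/
theorem lapNoise_shift_singleton {ι Γ : Type} {a : ι → ℝ} (ha : ∀ n, 0 < a n) (J : Finset ι)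
    {F G : (ι → ℤ) → Γ} (hF : DependsOn F J) (hG : DependsOn G J) (g : Γ) (c : ι → ℤ) {ε : ℝ}
    (hc : ∑ n ∈ J, a n * |(c n : ℝ)| ≤ ε) (h : ∀ ω, F ω = g → G (ω + c) = g) :
    lapNoise a (F ⁻¹' {g}) ≤ ENNReal.ofReal (Real.exp ε) * lapNoise a (G ⁻¹' {g}) := by
  classical
  -- As `F` and `G` depend on finitely many coordinates, both probabilities are sums over the points
  -- of the countable space `J → ℤ`, which can be compared point by point.
  let e : (J → ℤ) → (ι → ℤ) := fun z n => if h : n ∈ J then z ⟨n, h⟩ else 0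
  have he : ∀ ω, ∀ n ∈ (J : Set ι), ω n = e (J.restrict ω) n := by
    intro ω n hn
    have hn' : n ∈ J := hn
    simp [e, hn']
  set Q := Measure.pi (fun n : J => (lapPMF (a n)).toMeasure) with hQ
  have key : ∀ H : (ι → ℤ) → Γ, DependsOn H J →
      lapNoise a (H ⁻¹' {g}) = ∑' z : {z | H (e z) = g}, Q {z.1} := by
    intro H hH
    have h1 := tsum_measure_preimage_singleton (μ := Q) (f := id)
      (Set.to_countable {z | H (e z) = g}) fun y _ => (Set.to_countable _).measurableSet
    simp only [Set.preimage_id] at h1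
    rw [h1, hQ, ← Measure.infinitePi_map_restrict (fun n => (lapPMF (a n)).toMeasure),
      Measure.map_apply (Finset.measurable_restrict J) (Set.to_countable _).measurableSet]
    congr 1
    ext ω
    have := hH (he ω)
    simp [this]
  have hsing : ∀ z : J → ℤ, Q {z} ≤
      ENNReal.ofReal (Real.exp ε) * Q {z + J.restrict c} := by
    intro z
    simp only [Q, Measure.pi_singleton,
      PMF.toMeasure_apply_singleton _ _ (MeasurableSet.singleton _)]
    calc ∏ n : J, lapPMF (a n) (z n)
        ≤ ∏ n : J, (ENNReal.ofReal (Real.exp (a n * |((c n : ℤ) : ℝ)|)) *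
            lapPMF (a n) ((z + J.restrict c) n)) :=
          Finset.prod_le_prod' fun n _ => by
            have := lapPMF_le_shift (ha n) (z n) (c n)
            rwa [Int.cast_abs] at this
      _ = ENNReal.ofReal (Real.exp (∑ n ∈ J, a n * |(c n : ℝ)|)) *
            ∏ n : J, lapPMF (a n) ((z + J.restrict c) n) := by
          rw [Finset.prod_mul_distrib, ← ENNReal.ofReal_prod_of_nonneg
            (fun _ _ => (Real.exp_pos _).le), ← Real.exp_sum,
            ← Finset.sum_coe_sort J (fun n => a n * |(c n : ℝ)|)]
      _ ≤ _ := by gcongr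
  rw [key F hF, key G hG]
  have hmem : ∀ z, F (e z) = g → G (e (z + J.restrict c)) = g := by
    intro z hz
    rw [← h _ hz]
    refine hG fun n hn => ?_
    have hn' : n ∈ J := hn
    simp [e, hn']
  let f : {z | F (e z) = g} → {z | G (e z) = g} := fun z => ⟨z.1 + J.restrict c, hmem _ z.2⟩
  have hf : Function.Injective f := fun z w hzw =>
    Subtype.ext (add_right_cancel (congrArg Subtype.val hzw))
  calc ∑' z : {z | F (e z) = g}, Q {z.1}
      ≤ ∑' z : {z | F (e z) = g}, ENNReal.ofReal (Real.exp ε) * Q {(f z).1} :=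
        ENNReal.tsum_le_tsum fun z => hsing z.1
    _ = ENNReal.ofReal (Real.exp ε) * ∑' z : {z | F (e z) = g}, Q {(f z).1} := ENNReal.tsum_mul_left
    _ ≤ _ := by
        gcongr
        exact ENNReal.tsum_comp_le_tsum_of_injective hf fun w => Q {w.1}

/-- Privacy of a countably valued function `F` of the noise relative to another one, `G`: every
result may come with its own shift of the noise. -/
theorem lapNoise_shift {ι Γ : Type} [Countable Γ] {a : ι → ℝ} (ha : ∀ n, 0 < a n) (J : Finset ι)
    {F G : (ι → ℤ) → Γ} (hF : DependsOn F J) (hG : DependsOn G J) {ε : ℝ}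
    (h : ∀ g, ∃ c : ι → ℤ, ∑ n ∈ J, a n * |(c n : ℝ)| ≤ ε ∧ ∀ ω, F ω = g → G (ω + c) = g)
    (S : Set Γ) :
    lapNoise a (F ⁻¹' S) ≤ ENNReal.ofReal (Real.exp ε) * lapNoise a (G ⁻¹' S) := by
  rw [← tsum_measure_preimage_singleton S.to_countable
      fun y _ => measurableSet_of_dependsOn hF {y},
    ← tsum_measure_preimage_singleton S.to_countable
      fun y _ => measurableSet_of_dependsOn hG {y}, ← ENNReal.tsum_mul_left]
  refine ENNReal.tsum_le_tsum fun g => ?_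
  obtain ⟨c, hc, hFG⟩ := h g
  exact lapNoise_shift_singleton ha J hF hG g c hc hFG

/-! ### Union bound over time and queries -/

theorem sum_range_inv_mul_succ (n : ℕ) :
    ∑ t ∈ Finset.range n, (1 : ℝ) / ((t + 1) * (t + 2)) = 1 - 1 / (n + 1) := by
  induction n with
  | zero => simp
  | succ n ih =>
    rw [Finset.sum_range_succ, ih]
    push_cast
    field_simp
    ring

/-- Union bound over all times `t` and finitely many indices `i`, using `∑ 1/((t+1)(t+2)) = 1`. -/
theorem one_sub_le_of_bad {Ω I : Type} [Fintype I] [MeasurableSpace Ω] {P : Measure Ω}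
    [IsProbabilityMeasure P] {good : Set Ω} {bad : ℕ → I → Set Ω} {β : ℝ} (hβ : 0 < β)
    (hbad : ∀ t i, P (bad t i) ≤ ENNReal.ofReal (β / (Fintype.card I * ((t + 1) * (t + 2)))))
    (hgood : ∀ ω, (∀ t i, ω ∉ bad t i) → ω ∈ good) : ENNReal.ofReal (1 - β) ≤ P good := by
  have h1 : P (⋃ t, ⋃ i, bad t i) ≤ ENNReal.ofReal β := by
    refine (measure_iUnion_le _).trans ?_
    have h2 : ∀ t : ℕ, P (⋃ i, bad t i) ≤ ENNReal.ofReal (β * (1 / ((t + 1) * (t + 2)))) := by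
      intro t
      refine (measure_iUnion_fintype_le _ _).trans ((Finset.sum_le_sum fun i _ => hbad t i).trans ?_)
      rw [Finset.sum_const, Finset.card_univ, ← ENNReal.ofReal_nsmul]
      apply ENNReal.ofReal_le_ofReal
      rw [nsmul_eq_mul]
      rcases Nat.eq_zero_or_pos (Fintype.card I) with h | h
      · rw [h]; simp only [Nat.cast_zero, zero_mul]; positivity
      · have : (Fintype.card I : ℝ) ≠ 0 := by positivity
        apply le_of_eq
        field_simp
    refine (ENNReal.tsum_le_tsum h2).trans (ENNReal.tsum_le_of_sum_range_le fun n => ?_)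
    rw [← ENNReal.ofReal_sum_of_nonneg fun t _ => by positivity, ← Finset.mul_sum,
      sum_range_inv_mul_succ]
    apply ENNReal.ofReal_le_ofReal
    have : (0 : ℝ) ≤ 1 / (n + 1) := by positivity
    nlinarith
  have h2 : (1 : ENNReal) ≤ P good + P (⋃ t, ⋃ i, bad t i) := by
    rw [← measure_univ (μ := P)]
    refine (measure_mono fun ω _ => ?_).trans (measure_union_le _ _)
    by_cases h : ω ∈ ⋃ t, ⋃ i, bad t i
    · exact Or.inr h
    · left
      simp only [Set.mem_iUnion, not_exists] at h
      exact hgood ω h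
  rw [ENNReal.ofReal_sub _ hβ.le, ENNReal.ofReal_one]
  exact tsub_le_iff_right.mpr (h2.trans (add_le_add_right h1 _))

/-! ### Streams and their prefixes -/

theorem dataSet_congr {X : Type} {u : ℕ} (step : Finset (Fin u) → X → Finset (Fin u))
    {x y : ℕ → X} {t : ℕ} (h : ∀ s < t, x s = y s) : dataSet step x t = dataSet step y t := by
  induction t with
  | zero => rfl
  | succ t ih =>
    rw [dataSet, dataSet, ih fun s hs => h s (hs.trans (Nat.lt_succ_self t)),
      h t (Nat.lt_succ_self t)]

theorem getD_streamPrefix {X : Type} (x : ℕ → X) (d : X) {s t : ℕ} (h : s < t) :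
    (streamPrefix x t).getD s d = x s := by
  simp [streamPrefix, List.getD_eq_getElem?_getD, h]

theorem length_streamPrefix {X : Type} (x : ℕ → X) (t : ℕ) : (streamPrefix x t).length = t := by
  simp [streamPrefix]

/-! ### Dyadic decompositions -/

/-- The increment of `G` over the dyadic interval `[j * 2 ^ i, (j + 1) * 2 ^ i)`, where
`v = (i, j)`. -/
def dyadicDiff (G : ℕ → ℤ) (v : ℕ × ℕ) : ℤ := G ((v.2 + 1) * 2 ^ v.1) - G (v.2 * 2 ^ v.1)

theorem dyadicDiff_sub (G H : ℕ → ℤ) (v : ℕ × ℕ) :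
    dyadicDiff G v - dyadicDiff H v = dyadicDiff (fun n => G n - H n) v := by
  unfold dyadicDiff; ring

/-- Dyadic intervals of length less than `2 ^ k`, one for each nonzero binary digit of `n` below
the `k`-th, which make up `[(n / 2 ^ k) * 2 ^ k, n)`. -/
def oddNodes (k n : ℕ) : Finset (ℕ × ℕ) :=
  ((Finset.range k).filter fun i => n / 2 ^ i % 2 = 1).image fun i => (i, n / 2 ^ i - 1)

theorem sum_oddNodes {M : Type} [AddCommMonoid M] (k n : ℕ) (g : ℕ × ℕ → M) :
    ∑ v ∈ oddNodes k n, g v =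
      ∑ i ∈ Finset.range k, if n / 2 ^ i % 2 = 1 then g (i, n / 2 ^ i - 1) else 0 := by
  rw [oddNodes, Finset.sum_image fun i _ j _ h => (Prod.ext_iff.mp h).1, Finset.sum_filter]

theorem sum_dyadicDiff_oddNodes (G : ℕ → ℤ) (k n : ℕ) :
    ∑ v ∈ oddNodes k n, dyadicDiff G v = G n - G (n / 2 ^ k * 2 ^ k) := by
  rw [sum_oddNodes]
  induction k with
  | zero => simp
  | succ k ih =>
    rw [Finset.sum_range_succ, ih]
    have h2 : n / 2 ^ (k + 1) = n / 2 ^ k / 2 := by rw [pow_succ, Nat.div_div_eq_div_mul]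
    rw [h2]
    generalize n / 2 ^ k = a
    have h3 : a / 2 * 2 ^ (k + 1) = a / 2 * 2 * 2 ^ k := by ring
    rw [h3]
    split_ifs with h
    · have h4 : a / 2 * 2 = a - 1 := by omega
      have h5 : a - 1 + 1 = a := by omega
      simp only [dyadicDiff, h4, h5]
      ring
    · have h4 : a / 2 * 2 = a := by omega
      rw [h4]; ring

theorem card_oddNodes_le (k n : ℕ) : (oddNodes k n).card ≤ k :=
  Finset.card_image_le.trans ((Finset.card_filter_le _ _).trans (Finset.card_range k).le)

theorem mem_oddNodes {k n : ℕ} {v : ℕ × ℕ} (h : v ∈ oddNodes k n) :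
    v.1 < k ∧ (v.2 + 1) * 2 ^ v.1 ≤ n ∧ n / 2 ^ v.1 % 2 = 1 ∧ v.2 = n / 2 ^ v.1 - 1 := by
  simp only [oddNodes, Finset.mem_image, Finset.mem_filter, Finset.mem_range] at h
  obtain ⟨i, ⟨hi, ho⟩, rfl⟩ := h
  refine ⟨hi, ?_, ho, rfl⟩
  have : n / 2 ^ i - 1 + 1 = n / 2 ^ i := by generalize n / 2 ^ i = a at *; omega
  simp only [this]
  exact Nat.div_mul_le_self n (2 ^ i)

/-- Dyadic intervals which make up `[1, n)`, none of which contains `0`: the intervals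
`[2 ^ i, 2 ^ (i + 1))` up to the largest power of two below `n`, and then those given by the binary
digits of `n`. -/
def timeNodes (n : ℕ) : Finset (ℕ × ℕ) :=
  (Finset.range (Nat.log 2 n)).image (fun i => (i, 1)) ∪ oddNodes (Nat.log 2 n) n

theorem two_le_div_pow {n i : ℕ} (hi : i < Nat.log 2 n) : 2 ≤ n / 2 ^ i := by
  have hn : n ≠ 0 := by rintro rfl; simp at hi
  rw [Nat.le_div_iff_mul_le (by positivity), ← pow_succ']
  exact (Nat.pow_le_pow_right (by norm_num) hi).trans (Nat.pow_log_le_self 2 hn)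

theorem sum_timeNodes {M : Type} [AddCommMonoid M] (n : ℕ) (g : ℕ × ℕ → M) :
    ∑ v ∈ timeNodes n, g v =
      ∑ i ∈ Finset.range (Nat.log 2 n), g (i, 1) + ∑ v ∈ oddNodes (Nat.log 2 n) n, g v := by
  rw [timeNodes, Finset.sum_union, Finset.sum_image fun i _ j _ h => (Prod.ext_iff.mp h).1]
  rw [Finset.disjoint_left]
  rintro v hv hv'
  obtain ⟨h1, -, h2, h3⟩ := mem_oddNodes hv'
  obtain ⟨i, -, rfl⟩ := Finset.mem_image.mp hv
  have := two_le_div_pow h1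
  generalize n / 2 ^ (i, 1).1 = a at *
  simp only at h3
  omega

theorem sum_dyadicDiff_timeNodes (G : ℕ → ℤ) {n : ℕ} (hn : 1 ≤ n) :
    ∑ v ∈ timeNodes n, dyadicDiff G v = G n - G 1 := by
  rw [sum_timeNodes, sum_dyadicDiff_oddNodes]
  have h1 : n / 2 ^ Nat.log 2 n = 1 := by
    have := Nat.pow_log_le_self 2 (x := n) (by omega)
    have h2 := Nat.lt_pow_succ_log_self (b := 2) (by norm_num) n
    rw [Nat.div_eq_iff (by positivity)]
    rw [pow_succ] at h2
    omega
  have h2 : ∀ i, dyadicDiff G (i, 1) = G (2 ^ (i + 1)) - G (2 ^ i) := by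
    intro i
    simp only [dyadicDiff, one_mul, pow_succ']
  simp only [h2, h1, one_mul]
  rw [Finset.sum_range_sub (fun i => G (2 ^ i))]
  simp

theorem card_timeNodes_le (n : ℕ) : (timeNodes n).card ≤ 2 * Nat.log 2 n := by
  have h1 := card_oddNodes_le (Nat.log 2 n) n
  have h2 := Finset.card_image_le (s := Finset.range (Nat.log 2 n)) (f := fun i => (i, 1))
  rw [Finset.card_range] at h2
  have h3 := Finset.card_union_le ((Finset.range (Nat.log 2 n)).image (fun i => (i, 1)))
    (oddNodes (Nat.log 2 n) n)
  rw [timeNodes]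
  omega

theorem mem_timeNodes {n : ℕ} {v : ℕ × ℕ} (h : v ∈ timeNodes n) :
    1 ≤ v.2 ∧ (v.2 + 1) * 2 ^ v.1 ≤ n := by
  rcases Finset.mem_union.mp h with h | h
  · obtain ⟨i, hi, rfl⟩ := Finset.mem_image.mp h
    refine ⟨le_rfl, ?_⟩
    have hn : n ≠ 0 := by rintro rfl; simp at hi
    have := Nat.pow_le_pow_right (n := 2) (by norm_num) (Nat.succ_le_of_lt (Finset.mem_range.mp hi))
    have h2 := Nat.pow_log_le_self 2 hn
    simp only [Nat.succ_eq_add_one, pow_succ'] at this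
    change (1 + 1) * 2 ^ i ≤ n
    omega
  · obtain ⟨h1, h2, h3, h4⟩ := mem_oddNodes h
    have := two_le_div_pow h1
    exact ⟨by omega, h2⟩

/-- An interval `(i, j)` with `j ≠ 0` which contains `τ` lies within `[2 ^ k, 2 ^ (k + 1))` for
`k = Nat.log 2 τ`. -/
theorem log_node {i j τ : ℕ} (hj : 1 ≤ j) (h : τ / 2 ^ i = j) : i + Nat.log 2 j = Nat.log 2 τ := by
  have h1 : Nat.log 2 (τ / 2 ^ i) = Nat.log 2 τ - i := by rw [Nat.log_div_base_pow]
  have h2 : i ≤ Nat.log 2 τ := by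
    by_contra hc
    have : τ < 2 ^ i := (Nat.lt_pow_succ_log_self (b := 2) (by norm_num) τ).trans_le
      (Nat.pow_le_pow_right (by norm_num) (by omega))
    rw [Nat.div_eq_of_lt this] at h
    omega
  rw [← h, h1]; omega

/-- Triangle inequality for the increments of `G`, bounded by `g`. -/
theorem abs_dyadicDiff_le {G : ℕ → ℤ} {g : ℕ → ℤ} (hG : ∀ n, |G (n + 1) - G n| ≤ g n) {v : ℕ × ℕ}
    {T : ℕ} (h1 : 1 ≤ v.2) (h2 : (v.2 + 1) * 2 ^ v.1 ≤ T + 1) :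
    |dyadicDiff G v| ≤ ∑ τ ∈ Finset.Icc 1 T, if τ / 2 ^ v.1 = v.2 then g τ else 0 := by
  have hle : v.2 * 2 ^ v.1 ≤ (v.2 + 1) * 2 ^ v.1 := by gcongr; omega
  have : (Finset.Icc 1 T).filter (fun τ => τ / 2 ^ v.1 = v.2) =
      Finset.Ico (v.2 * 2 ^ v.1) ((v.2 + 1) * 2 ^ v.1) := by
    ext τ
    have hp : 0 < 2 ^ v.1 := by positivity
    have h3 : 1 ≤ v.2 * 2 ^ v.1 := Nat.mul_pos h1 hp
    rw [Finset.mem_filter, Finset.mem_Icc, Finset.mem_Ico, Nat.div_eq_iff hp]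
    rw [add_mul, one_mul] at *
    omega
  rw [← Finset.sum_filter, this, dyadicDiff, ← Finset.sum_Ico_sub _ hle]
  exact (Finset.abs_sum_le_sum_abs _ _).trans (Finset.sum_le_sum fun n _ => hG n)

/-! ### Relaxed predecessors from prefix counts -/

/-- The number of elements of `D` below `m`. -/
def countBelow {u : ℕ} (D : Finset (Fin u)) (m : ℕ) : ℕ := (D.filter fun e => e.val < m).card

theorem countBelow_eq_add {u : ℕ} (D : Finset (Fin u)) {p q : Fin u} (h : p ≤ q) :
    countBelow D (q + 1) = countBelow D p + (D ∩ Finset.Icc p q).card := by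
  rw [countBelow, countBelow, ← Finset.card_union_of_disjoint]
  · congr 1
    ext e
    simp only [Finset.mem_filter, Finset.mem_union, Finset.mem_inter, Finset.mem_Icc, Fin.le_def]
    have : p.val ≤ q.val := h
    by_cases he : e ∈ D
    · simp only [he, true_and]; omega
    · simp only [he, false_and, or_false]
  · rw [Finset.disjoint_left]
    intro e h1 h2
    simp only [Finset.mem_filter, Finset.mem_inter, Finset.mem_Icc, Fin.le_def] at h1 h2
    omega

/-- The answer to the query `q` given estimates `c m` of the numbers of elements below `m`, up to
an error `E`: the largest `p ≤ q` whose interval `[p, q]` has an estimated size above `2 * E`. -/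
noncomputable def predAnswer {u : ℕ} (c : ℕ → ℝ) (E : ℝ) (q : Fin u) : Option (Fin u) :=
  open Classical in
  if h : (Finset.univ.filter fun p : Fin u => p ≤ q ∧ 2 * E < c (q + 1) - c p).Nonempty then
    some (Finset.max' _ h)
  else none

theorem isRelaxedPred_predAnswer {u : ℕ} (D : Finset (Fin u)) (c : ℕ → ℝ) {E : ℝ} (hE : 0 ≤ E)
    (hc : ∀ m ≤ u, |c m - countBelow D m| ≤ E) (q : Fin u) :
    IsRelaxedPred D (4 * E + 1) q (predAnswer c E q) := by
  classical
  have hcount : ∀ p : Fin u, p ≤ q → ((D ∩ Finset.Icc p q).card : ℝ) ≤ c (q + 1) - c p + 2 * E ∧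
      c (q + 1) - c p - 2 * E ≤ ((D ∩ Finset.Icc p q).card : ℝ) := by
    intro p hp
    have h1 := abs_le.mp (hc (q + 1) q.2)
    have h2 := abs_le.mp (hc p p.2.le)
    have h3 : (countBelow D (q + 1) : ℝ) = countBelow D p + (D ∩ Finset.Icc p q).card := by
      exact_mod_cast countBelow_eq_add D hp
    constructor <;> linarith [h1.1, h1.2, h2.1, h2.2]
  rw [predAnswer]
  split_ifs with h
  · have hmem := Finset.max'_mem _ h
    have hmax := fun p => Finset.le_max' (Finset.univ.filter fun p : Fin u =>
      p ≤ q ∧ 2 * E < c (q + 1) - c p) p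
    set x := Finset.max' _ h
    obtain ⟨-, hxq, hx⟩ := Finset.mem_filter.mp hmem
    refine ⟨?_, ?_⟩
    · have := (hcount x hxq).2
      have h0 : (0 : ℝ) < ((D ∩ Finset.Icc x q).card : ℝ) := by linarith
      exact_mod_cast h0
    · rcases hxq.eq_or_lt with he | hlt
      · rw [he, Finset.Icc_self]
        have h1 : ((D ∩ {q}).card : ℝ) ≤ 1 := by
          exact_mod_cast (Finset.card_le_card Finset.inter_subset_right).trans
            (Finset.card_singleton q).le
        linarith
      · -- By maximality of `x`, the interval `[x + 1, q]` has at most `4 * E` elements.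
        have hx1 : x.val + 1 < u := by have := q.2; have : x.val < q.val := hlt; omega
        let y : Fin u := ⟨x.val + 1, hx1⟩
        have hyq : y ≤ q := by
          have : x.val < q.val := hlt
          change x.val + 1 ≤ q.val
          omega
        have hy : c (q + 1) - c y ≤ 2 * E := by
          by_contra hcon
          have := hmax y (by simp only [Finset.mem_filter, Finset.mem_univ, true_and]
                             exact ⟨hyq, not_le.mp hcon⟩)
          have : x.val + 1 ≤ x.val := this
          omega
        have h2 : D ∩ Finset.Icc x q ⊆ insert x (D ∩ Finset.Icc y q) := by
          intro e he
          simp only [Finset.mem_inter, Finset.mem_Icc, Finset.mem_insert, Fin.le_def] at he ⊢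
          by_cases hex : e = x
          · exact Or.inl hex
          · have : e.val ≠ x.val := fun h => hex (Fin.ext h)
            have hyv : y.val = x.val + 1 := rfl
            exact Or.inr ⟨he.1, by omega, he.2.2⟩
        have h3 : ((D ∩ Finset.Icc x q).card : ℝ) ≤ (D ∩ Finset.Icc y q).card + 1 := by
          exact_mod_cast (Finset.card_le_card h2).trans (Finset.card_insert_le _ _)
        linarith [(hcount y hyq).1]
  · let z : Fin u := ⟨0, q.pos⟩
    have hz : z ≤ q := Fin.le_def.mpr (Nat.zero_le _)
    have h1 : c (q + 1) - c z ≤ 2 * E := by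
      by_contra hcon
      exact h ⟨z, by simp only [Finset.mem_filter, Finset.mem_univ, true_and]
                     exact ⟨hz, not_le.mp hcon⟩⟩
    have h2 : D ∩ Finset.Iic q ⊆ D ∩ Finset.Icc z q := by
      intro e he
      simp only [Finset.mem_inter, Finset.mem_Icc, Finset.mem_Iic] at he ⊢
      exact ⟨he.1, Fin.le_def.mpr (Nat.zero_le _), he.2⟩
    have h3 : ((D ∩ Finset.Iic q).card : ℝ) ≤ (D ∩ Finset.Icc z q).card := by
      exact_mod_cast Finset.card_le_card h2
    change ((D ∩ Finset.Iic q).card : ℝ) ≤ 4 * E + 1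
    linarith [(hcount z hz).1]

theorem predAnswer_congr {u : ℕ} {c c' : ℕ → ℝ} {E : ℝ} (h : ∀ m ≤ u, c m = c' m) :
    (predAnswer c E : Fin u → Option (Fin u)) = predAnswer c' E := by
  funext q
  have h1 : ∀ p : Fin u, c p = c' p := fun p => h p p.2.le
  simp only [predAnswer, h (q + 1) q.2, h1]

/-! ### Sensitivity of fully dynamic data sets -/

/-- The elements which an update may insert or delete. -/
def FullUpdate.touched {u : ℕ} : FullUpdate u → Finset (Fin u)
  | .insert x => {x}
  | .delete x => {x}
  | .idle => ∅

theorem FullUpdate.card_touched_le {u : ℕ} (a : FullUpdate u) : a.touched.card ≤ 1 := by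
  cases a <;> simp [touched]

theorem FullUpdate.mem_step_of_notMem {u : ℕ} (D : Finset (Fin u)) {a : FullUpdate u} {e : Fin u}
    (h : e ∉ a.touched) : e ∈ a.step D ↔ e ∈ D := by
  cases a <;> simp_all [touched, step]

/-- An update either decides whether `e` is present, whatever the data set was, or does not
affect `e`. -/
theorem FullUpdate.mem_step_cases {u : ℕ} (a : FullUpdate u) (e : Fin u) :
    (∀ D D' : Finset (Fin u), e ∈ a.step D ↔ e ∈ a.step D') ∨
      ∀ D : Finset (Fin u), e ∈ a.step D ↔ e ∈ D := by
  by_cases h : e ∈ a.touched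
  · left
    intro D D'
    cases a <;> simp_all [touched, step]
  · exact Or.inr fun D => mem_step_of_notMem D h

/-- The indicator function of a data set. -/
def memInd {u : ℕ} (D : Finset (Fin u)) (e : Fin u) : ℤ := if e ∈ D then 1 else 0

theorem memInd_congr {u : ℕ} {D D' : Finset (Fin u)} {e : Fin u} (h : e ∈ D ↔ e ∈ D') :
    memInd D e = memInd D' e := by
  simp only [memInd, h]

theorem memInd_eq_zero_or_one {u : ℕ} (D : Finset (Fin u)) (e : Fin u) :
    memInd D e = 0 ∨ memInd D e = 1 := by
  unfold memInd; split_ifs <;> simp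

/-- The difference at time `t` of the indicator functions of the data sets of two streams. -/
def memDiff {u : ℕ} (x y : ℕ → FullUpdate u) (t : ℕ) (e : Fin u) : ℤ :=
  memInd (dataSet FullUpdate.step x t) e - memInd (dataSet FullUpdate.step y t) e

theorem memDiff_succ_le {u : ℕ} {x y : ℕ → FullUpdate u} {s : ℕ} (h : ∀ i, i ≠ s → x i = y i)
    (t : ℕ) (e : Fin u) :
    |memDiff x y (t + 1) e - memDiff x y t e| + |memDiff x y (t + 1) e| ≤ |memDiff x y t e| +
      if t = s then (if e ∈ (x s).touched ∪ (y s).touched then 2 else 0) else 0 := by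
  by_cases ht : t = s
  · subst ht
    simp only [memDiff, dataSet, if_true]
    by_cases he : e ∈ (x t).touched ∪ (y t).touched
    · rw [if_pos he]
      rcases memInd_eq_zero_or_one (FullUpdate.step (dataSet FullUpdate.step x t) (x t)) e
        with h1 | h1 <;>
      rcases memInd_eq_zero_or_one (FullUpdate.step (dataSet FullUpdate.step y t) (y t)) e
        with h2 | h2 <;>
      rcases memInd_eq_zero_or_one (dataSet FullUpdate.step x t) e with h3 | h3 <;>
      rcases memInd_eq_zero_or_one (dataSet FullUpdate.step y t) e with h4 | h4 <;>
      rw [h1, h2, h3, h4] <;> decide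
    · rw [if_neg he]
      rw [Finset.mem_union, not_or] at he
      rw [memInd_congr (FullUpdate.mem_step_of_notMem _ he.1),
        memInd_congr (FullUpdate.mem_step_of_notMem _ he.2)]
      simp
  · simp only [memDiff, dataSet, ht, if_false, h t ht]
    rcases (y t).mem_step_cases e with h1 | h1
    · rw [memInd_congr (h1 (dataSet FullUpdate.step x t) (dataSet FullUpdate.step y t))]
      simp [abs_sub_comm]
    · rw [memInd_congr (h1 (dataSet FullUpdate.step x t)),
        memInd_congr (h1 (dataSet FullUpdate.step y t))]
      simp

/-- The `2` accounts for the change at the step `s` and for the one at the next update of `e`. -/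
theorem sum_memDiff_le {u : ℕ} {x y : ℕ → FullUpdate u} {s : ℕ} (h : ∀ i, i ≠ s → x i = y i)
    (e : Fin u) (T : ℕ) :
    ∑ t ∈ Finset.range T, |memDiff x y (t + 1) e - memDiff x y t e| ≤
      if e ∈ (x s).touched ∪ (y s).touched then 2 else 0 := by
  have key : ∑ t ∈ Finset.range T, |memDiff x y (t + 1) e - memDiff x y t e| + |memDiff x y T e| ≤
      ∑ t ∈ Finset.range T,
        if t = s then (if e ∈ (x s).touched ∪ (y s).touched then (2 : ℤ) else 0) else 0 := by
    induction T with
    | zero => simp [memDiff, dataSet]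
    | succ T ih =>
      rw [Finset.sum_range_succ, Finset.sum_range_succ]
      linarith [memDiff_succ_le h T e]
  have h2 : ∑ t ∈ Finset.range T,
        (if t = s then (if e ∈ (x s).touched ∪ (y s).touched then (2 : ℤ) else 0) else 0) ≤
      if e ∈ (x s).touched ∪ (y s).touched then 2 else 0 := by
    rw [Finset.sum_ite_eq']
    split_ifs <;> simp
  linarith [abs_nonneg (memDiff x y T e)]

/-- Changing one update changes the stream of insertions into and deletions from the data set by at
most four: the touched elements change at that time step and at their next update. -/
theorem sum_sum_memDiff_le {u : ℕ} {x y : ℕ → FullUpdate u} (h : Neighboring x y) (T : ℕ) :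
    ∑ e : Fin u, ∑ t ∈ Finset.range T, |memDiff x y (t + 1) e - memDiff x y t e| ≤ 4 := by
  obtain ⟨s, hs⟩ := h
  refine (Finset.sum_le_sum fun e _ => sum_memDiff_le hs e T).trans ?_
  rw [← Finset.sum_filter, Finset.sum_const, Finset.filter_univ_mem, nsmul_eq_mul]
  have h1 := Finset.card_union_le (x s).touched (y s).touched
  have h2 := (x s).card_touched_le
  have h3 := (y s).card_touched_le
  have : (((x s).touched ∪ (y s).touched).card : ℤ) ≤ 2 := by omega
  linarith

/-! ### Two-dimensional dyadic counters -/

/-- A counter: a dyadic interval of times together with a dyadic interval of the universe. -/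
abbrev Counter : Type := (ℕ × ℕ) × (ℕ × ℕ)

/-- The net change during the times `τ` in the first interval of the number of elements of the data
set in the second interval. The update of time step `τ` changes `D (τ - 1)` to `D τ`. -/
def counterVal {u : ℕ} (x : ℕ → FullUpdate u) (n : Counter) : ℤ :=
  dyadicDiff (fun τ => dyadicDiff
    (fun m => (countBelow (dataSet FullUpdate.step x (τ - 1)) m : ℤ)) n.2) n.1

/-- The number of levels of the dyadic intervals of a universe of `u` elements. -/
def levels (u : ℕ) : ℕ := Nat.log 2 u + 1

theorem lt_two_pow_levels (u : ℕ) : u < 2 ^ levels u :=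
  Nat.lt_pow_succ_log_self (by norm_num) u

/-- The noisy estimate, with noise `ω`, of the number of elements below `m` at time `t`. -/
def prefixEst {u : ℕ} (x : ℕ → FullUpdate u) (ω : Counter → ℤ) (t m : ℕ) : ℤ :=
  ∑ n ∈ timeNodes (t + 1) ×ˢ oddNodes (levels u) m, (counterVal x n + ω n)

/-- The counters of `prefixEst` telescope in both directions. -/
theorem prefixEst_eq {u : ℕ} (x : ℕ → FullUpdate u) (ω : Counter → ℤ) (t : ℕ) {m : ℕ} (hm : m ≤ u) :
    prefixEst x ω t m = countBelow (dataSet FullUpdate.step x t) m +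
      ∑ n ∈ timeNodes (t + 1) ×ˢ oddNodes (levels u) m, ω n := by
  rw [prefixEst, Finset.sum_add_distrib]
  congr 1
  rw [Finset.sum_product_right]
  simp only [counterVal]
  have h1 : ∀ w, ∑ v ∈ timeNodes (t + 1), dyadicDiff (fun τ => dyadicDiff
      (fun m => (countBelow (dataSet FullUpdate.step x (τ - 1)) m : ℤ)) w) v =
      dyadicDiff (fun m => (countBelow (dataSet FullUpdate.step x t) m : ℤ)) w := by
    intro w
    rw [sum_dyadicDiff_timeNodes _ (by omega)]
    simp [dataSet, dyadicDiff, countBelow]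
  simp only [h1]
  rw [sum_dyadicDiff_oddNodes, Nat.div_eq_of_lt (hm.trans_lt (lt_two_pow_levels u))]
  simp [countBelow]

theorem counterVal_congr {u : ℕ} {x y : ℕ → FullUpdate u} {t : ℕ} (h : ∀ s < t, x s = y s)
    {n : Counter} (hn : (n.1.2 + 1) * 2 ^ n.1.1 ≤ t + 1) : counterVal x n = counterVal y n := by
  have : ∀ τ ≤ t + 1, dataSet FullUpdate.step x (τ - 1) = dataSet FullUpdate.step y (τ - 1) :=
    fun τ hτ => dataSet_congr _ fun s hs => h s (by omega)
  have hle : n.1.2 * 2 ^ n.1.1 ≤ (n.1.2 + 1) * 2 ^ n.1.1 := by gcongr; omega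
  simp only [counterVal]
  unfold dyadicDiff
  simp only [this _ hn, this _ (hle.trans hn)]

theorem prefixEst_congr {u : ℕ} {x y : ℕ → FullUpdate u} {t : ℕ} (h : ∀ s < t, x s = y s)
    (ω : Counter → ℤ) (m : ℕ) : prefixEst x ω t m = prefixEst y ω t m := by
  refine Finset.sum_congr rfl fun n hn => ?_
  rw [counterVal_congr h (mem_timeNodes (Finset.mem_product.mp hn).1).2]

/-- The counters which matter for the answers up to time `T`. -/
def activeCounters (u T : ℕ) : Finset Counter :=
  ((Finset.range (T + 1) ×ˢ Finset.range (T + 1)).filter fun v =>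
    1 ≤ v.2 ∧ (v.2 + 1) * 2 ^ v.1 ≤ T + 1) ×ˢ (Finset.range (levels u) ×ˢ Finset.range (u + 1))

theorem mem_activeCounters {u t T m : ℕ} (ht : t ≤ T) (hm : m ≤ u) {n : Counter}
    (hn : n ∈ timeNodes (t + 1) ×ˢ oddNodes (levels u) m) : n ∈ activeCounters u T := by
  obtain ⟨h1, h2⟩ := Finset.mem_product.mp hn
  obtain ⟨h3, h4⟩ := mem_timeNodes h1
  obtain ⟨h5, h6, -⟩ := mem_oddNodes h2
  have lt : ∀ a b c : ℕ, (a + 1) * 2 ^ b ≤ c → a < c ∧ b < c := by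
    intro a b c h
    have h7 := Nat.lt_two_pow_self (n := b)
    have h8 : a + 1 ≤ (a + 1) * 2 ^ b := Nat.le_mul_of_pos_right _ (by positivity)
    have h9 : 2 ^ b ≤ (a + 1) * 2 ^ b := Nat.le_mul_of_pos_left _ (by omega)
    omega
  have := lt _ _ _ h4
  have := lt _ _ _ h6
  simp only [activeCounters, Finset.mem_product, Finset.mem_filter, Finset.mem_range]
  omega

theorem prefixEst_shift {u : ℕ} {x y : ℕ → FullUpdate u} {ω ω' : Counter → ℤ} {t T m : ℕ}
    (ht : t ≤ T) (hm : m ≤ u)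
    (h : ∀ n ∈ activeCounters u T, counterVal x n + ω n = counterVal y n + ω' n) :
    prefixEst x ω t m = prefixEst y ω' t m :=
  Finset.sum_congr rfl fun n hn => h n (mem_activeCounters ht hm hn)

/-- The rate of the noise of a counter. With `k = n.1.1 + Nat.log 2 n.1.2` its times lie in
`[2 ^ k, 2 ^ (k + 1))`, and each of these times is in `k + 1` of the time intervals. -/
noncomputable def counterRate (u : ℕ) (ε : ℝ) (n : Counter) : ℝ :=
  ε / (4 * levels u * ((n.1.1 + Nat.log 2 n.1.2 : ℕ) + 1))

theorem levels_pos (u : ℕ) : (0 : ℝ) < levels u := by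
  unfold levels; positivity

theorem counterRate_pos (u : ℕ) {ε : ℝ} (hε : 0 < ε) (n : Counter) : 0 < counterRate u ε n := by
  have := levels_pos u
  unfold counterRate; positivity

theorem abs_counterVal_sub_le {u : ℕ} (x y : ℕ → FullUpdate u) {T : ℕ} {n : Counter}
    (h1 : 1 ≤ n.1.2) (h2 : (n.1.2 + 1) * 2 ^ n.1.1 ≤ T + 1) :
    |counterVal x n - counterVal y n| ≤ ∑ e : Fin u, ∑ t ∈ Finset.range T,
      if (t + 1) / 2 ^ n.1.1 = n.1.2 ∧ e.val / 2 ^ n.2.1 = n.2.2 then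
        |memDiff x y (t + 1) e - memDiff x y t e| else 0 := by
  have hdiff : ∀ τ, dyadicDiff
      (fun m => (countBelow (dataSet FullUpdate.step x (τ - 1)) m : ℤ)) n.2 -
      dyadicDiff (fun m => (countBelow (dataSet FullUpdate.step y (τ - 1)) m : ℤ)) n.2 =
      ∑ e : Fin u, if e.val / 2 ^ n.2.1 = n.2.2 then memDiff x y (τ - 1) e else 0 := by
    have hcard : ∀ D : Finset (Fin u), dyadicDiff (fun m => (countBelow D m : ℤ)) n.2 =
        ∑ e : Fin u, if e.val / 2 ^ n.2.1 = n.2.2 then memInd D e else 0 := by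
      intro D
      have hc : ∀ m, (countBelow D m : ℤ) = ∑ e : Fin u, if e.val < m then memInd D e else 0 := by
        intro m
        have : D.filter (fun e => e.val < m) = Finset.univ.filter fun e => e ∈ D ∧ e.val < m := by
          ext e; simp
        rw [countBelow, this, Finset.card_filter, Nat.cast_sum]
        refine Finset.sum_congr rfl fun e _ => ?_
        unfold memInd
        split_ifs <;> simp_all
      rw [dyadicDiff, hc, hc, ← Finset.sum_sub_distrib]
      refine Finset.sum_congr rfl fun e _ => ?_
      have hp : 0 < 2 ^ n.2.1 := by positivity
      have h3 := Nat.div_eq_iff (x := e.val) (y := n.2.2) hp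
      rw [if_congr h3 rfl rfl]
      rw [add_mul, one_mul]
      split_ifs <;> first | rfl | omega
    intro τ
    rw [hcard, hcard, ← Finset.sum_sub_distrib]
    refine Finset.sum_congr rfl fun e _ => ?_
    split_ifs <;> simp [memDiff, *]
  have h3 : counterVal x n - counterVal y n = dyadicDiff (fun τ => ∑ e : Fin u,
      if e.val / 2 ^ n.2.1 = n.2.2 then memDiff x y (τ - 1) e else 0) n.1 := by
    simp only [← hdiff]
    exact dyadicDiff_sub _ _ _
  rw [h3]
  refine (abs_dyadicDiff_le (T := T) (g := fun τ => ∑ e : Fin u,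
      if e.val / 2 ^ n.2.1 = n.2.2 then |memDiff x y τ e - memDiff x y (τ - 1) e| else 0)
      (fun τ => ?_) h1 h2).trans (le_of_eq ?_)
  · rw [← Finset.sum_sub_distrib]
    refine (Finset.abs_sum_le_sum_abs _ _).trans (Finset.sum_le_sum fun e _ => ?_)
    rw [Nat.add_sub_cancel]
    split_ifs <;> simp
  · have hI : Finset.Icc 1 T = (Finset.range T).image (· + 1) := by
      ext τ
      simp only [Finset.mem_Icc, Finset.mem_image, Finset.mem_range]
      exact ⟨fun h => ⟨τ - 1, by omega, by omega⟩, fun ⟨t, h, h'⟩ => by omega⟩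
    rw [hI, Finset.sum_image fun _ _ _ _ h => Nat.succ_injective h, Finset.sum_comm]
    refine Finset.sum_congr rfl fun t _ => ?_
    by_cases ht : (t + 1) / 2 ^ n.1.1 = n.1.2 <;> simp [ht]

/-- The total privacy loss of all counters: a single insertion or deletion at time `τ` loses
`ε / 4`, as it is counted in at most `levels u * (Nat.log 2 τ + 1)` counters. -/
theorem sum_counterRate_mul_le {u : ℕ} {x y : ℕ → FullUpdate u} (h : Neighboring x y) {ε : ℝ}
    (hε : 0 < ε) (T : ℕ) :
    ∑ n ∈ activeCounters u T, counterRate u ε n * |((counterVal x n - counterVal y n : ℤ) : ℝ)| ≤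
      ε := by
  have hL := levels_pos u
  let δ : ℕ → Fin u → ℝ := fun t e => |((memDiff x y (t + 1) e - memDiff x y t e : ℤ) : ℝ)|
  have h1 : ∀ n ∈ activeCounters u T,
      counterRate u ε n * |((counterVal x n - counterVal y n : ℤ) : ℝ)| ≤
        ∑ e : Fin u, ∑ t ∈ Finset.range T,
          if (t + 1) / 2 ^ n.1.1 = n.1.2 ∧ e.val / 2 ^ n.2.1 = n.2.2 then
            counterRate u ε n * δ t e else 0 := by
    intro n hn
    simp only [activeCounters, Finset.mem_product, Finset.mem_filter] at hn
    have h2 := abs_counterVal_sub_le x y hn.1.2.1 hn.1.2.2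
    have h3 : |((counterVal x n - counterVal y n : ℤ) : ℝ)| ≤ ∑ e : Fin u, ∑ t ∈ Finset.range T,
        if (t + 1) / 2 ^ n.1.1 = n.1.2 ∧ e.val / 2 ^ n.2.1 = n.2.2 then δ t e else 0 := by
      have h4 := (Int.cast_le (R := ℝ)).mpr h2
      simpa only [Int.cast_sum, Int.cast_ite, Int.cast_abs, Int.cast_zero, δ] using h4
    refine (mul_le_mul_of_nonneg_left h3 (counterRate_pos u hε n).le).trans (le_of_eq ?_)
    simp only [Finset.mul_sum, mul_ite, mul_zero]
  have h2 : ∀ (e : Fin u) (t : ℕ), (∑ n ∈ activeCounters u T,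
      if (t + 1) / 2 ^ n.1.1 = n.1.2 ∧ e.val / 2 ^ n.2.1 = n.2.2 then
        counterRate u ε n * δ t e else 0) ≤ ε / 4 * δ t e := by
    intro e t
    rw [← Finset.sum_filter, ← Finset.sum_mul]
    refine mul_le_mul_of_nonneg_right ?_ (abs_nonneg _)
    set A := (activeCounters u T).filter fun n : Counter =>
      (t + 1) / 2 ^ n.1.1 = n.1.2 ∧ e.val / 2 ^ n.2.1 = n.2.2 with hA
    set k := Nat.log 2 (t + 1) with hk
    have hmem : ∀ n ∈ A, 1 ≤ n.1.2 ∧ n.2.1 < levels u ∧ (t + 1) / 2 ^ n.1.1 = n.1.2 ∧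
        e.val / 2 ^ n.2.1 = n.2.2 := by
      intro n hn
      simp only [hA, activeCounters, Finset.mem_product, Finset.mem_filter, Finset.mem_range] at hn
      tauto
    have hrate : ∀ n ∈ A, counterRate u ε n = ε / (4 * levels u * ((k : ℝ) + 1)) := by
      intro n hn
      rw [counterRate, log_node (hmem n hn).1 (hmem n hn).2.2.1]
    have hcard : A.card ≤ (k + 1) * levels u := by
      rw [← Finset.card_range (k + 1), ← Finset.card_range (levels u), ← Finset.card_product]
      refine Finset.card_le_card_of_injOn (fun n => (n.1.1, n.2.1)) ?_ ?_
      · intro n hn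
        have h3 := hmem n hn
        have h4 := log_node h3.1 h3.2.2.1
        simp only [Finset.coe_product, Set.mem_prod, Finset.coe_range, Set.mem_Iio]
        exact ⟨by omega, h3.2.1⟩
      · intro n hn n' hn' heq
        have h3 := hmem n hn
        have h4 := hmem n' hn'
        simp only [Prod.mk.injEq] at heq
        refine Prod.ext (Prod.ext heq.1 ?_) (Prod.ext heq.2 ?_)
        · rw [← h3.2.2.1, ← h4.2.2.1, heq.1]
        · rw [← h3.2.2.2, ← h4.2.2.2, heq.2]
    rw [Finset.sum_congr rfl hrate, Finset.sum_const, nsmul_eq_mul]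
    have h5 : (A.card : ℝ) ≤ ((k : ℝ) + 1) * levels u := by exact_mod_cast hcard
    calc (A.card : ℝ) * (ε / (4 * levels u * ((k : ℝ) + 1)))
        ≤ ((k : ℝ) + 1) * levels u * (ε / (4 * levels u * ((k : ℝ) + 1))) := by gcongr
      _ = ε / 4 := by field_simp
  have h3 : ∑ e : Fin u, ∑ t ∈ Finset.range T, δ t e ≤ 4 := by
    have h4 := (Int.cast_le (R := ℝ)).mpr (sum_sum_memDiff_le h T)
    simpa only [Int.cast_sum, Int.cast_abs, Int.cast_ofNat, δ] using h4
  calc _ ≤ ∑ n ∈ activeCounters u T, ∑ e : Fin u, ∑ t ∈ Finset.range T,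
          (if (t + 1) / 2 ^ n.1.1 = n.1.2 ∧ e.val / 2 ^ n.2.1 = n.2.2 then
            counterRate u ε n * δ t e else 0) := Finset.sum_le_sum h1
    _ = ∑ e : Fin u, ∑ t ∈ Finset.range T, ∑ n ∈ activeCounters u T,
          (if (t + 1) / 2 ^ n.1.1 = n.1.2 ∧ e.val / 2 ^ n.2.1 = n.2.2 then
            counterRate u ε n * δ t e else 0) := by
        rw [Finset.sum_comm]
        exact Finset.sum_congr rfl fun e _ => Finset.sum_comm
    _ ≤ ∑ e : Fin u, ∑ t ∈ Finset.range T, ε / 4 * δ t e :=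
        Finset.sum_le_sum fun e _ => Finset.sum_le_sum fun t _ => h2 e t
    _ = ε / 4 * ∑ e : Fin u, ∑ t ∈ Finset.range T, δ t e := by simp only [Finset.mul_sum]
    _ ≤ ε := by nlinarith

/-! ### The fully dynamic mechanism -/

/-- The parameter `l` for which the tail bound `2 * exp (-l)` is the share
`β / (I * ((t + 1) * (t + 2)))` of the failure probability granted at time `t` to one of `I`
events. -/
noncomputable def logFail (I β : ℝ) (t : ℕ) : ℝ := Real.log (2 * I * ((t + 1) * (t + 2)) / β)

theorem logFail_arg {I β : ℝ} (hI : 1 ≤ I) (hβ1 : β < 1) (hβ : 0 < β) (t : ℕ) :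
    1 < 2 * I * ((t + 1) * (t + 2)) / β := by
  rw [lt_div_iff₀ hβ]
  have h0 : (0 : ℝ) ≤ t := by positivity
  have h1 : (1 : ℝ) ≤ (t + 1) * (t + 2) := by nlinarith
  have := one_le_mul_of_one_le_of_one_le hI h1
  linarith

theorem logFail_pos {I β : ℝ} (hI : 1 ≤ I) (hβ1 : β < 1) (hβ : 0 < β) (t : ℕ) :
    0 < logFail I β t := Real.log_pos (logFail_arg hI hβ1 hβ t)

theorem logFail_mono {I β : ℝ} (hI : 1 ≤ I) (hβ1 : β < 1) (hβ : 0 < β) : Monotone (logFail I β) := by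
  intro s t hst
  refine Real.log_le_log (by linarith [logFail_arg hI hβ1 hβ s]) ?_
  gcongr

theorem two_mul_exp_neg_logFail {I β : ℝ} (hI : 1 ≤ I) (hβ1 : β < 1) (hβ : 0 < β) (t : ℕ) :
    2 * Real.exp (-logFail I β t) = β / (I * ((t + 1) * (t + 2))) := by
  rw [Real.exp_neg, logFail, Real.exp_log (by linarith [logFail_arg hI hβ1 hβ t])]
  field_simp

/-- A lower bound for the rates of the counters in use at time `t`. -/
noncomputable def minRate (u : ℕ) (ε : ℝ) (t : ℕ) : ℝ :=
  ε / (4 * levels u * ((Nat.log 2 (t + 1) : ℕ) + 1))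

/-- An upper bound for the number of counters which make up a prefix count at time `t`. -/
noncomputable def maxCounters (u t : ℕ) : ℝ := 2 * levels u * ((Nat.log 2 (t + 1) : ℕ) + 1)

/-- The error of the prefix counts at time `t`: the bound of `lapNoise_sum_tail`. -/
noncomputable def prefixErr (u : ℕ) (ε β : ℝ) (t : ℕ) : ℝ :=
  3 / minRate u ε t * √((maxCounters u t + logFail u β t) * logFail u β t)

/-- The fully dynamic mechanism: two-dimensional dyadic counters with discrete Laplace noise, whose
sums estimate the prefix counts from which relaxed predecessors are read off. -/
noncomputable def fullMechanism (u : ℕ) (ε β : ℝ) : PredMechanism (FullUpdate u) u where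
  Ω := Counter → ℤ
  mΩ := inferInstance
  P := lapNoise (counterRate u ε)
  isProb := inferInstance
  out l ω := predAnswer (fun m => prefixEst (fun i => l.getD i .idle) ω l.length m)
    (prefixErr u ε β l.length)
  measurable_out l S := by
    refine measurableSet_of_dependsOn (J := activeCounters u l.length) (fun ω ω' h => ?_) S
    refine predAnswer_congr fun m hm => ?_
    rw [prefixEst_shift le_rfl hm fun n hn => by rw [h n hn]]

theorem fullMechanism_out {u : ℕ} (ε β : ℝ) (x : ℕ → FullUpdate u) (t : ℕ) (ω : Counter → ℤ) :
    (fullMechanism u ε β).out (streamPrefix x t) ω =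
      predAnswer (fun m => prefixEst x ω t m) (prefixErr u ε β t) := by
  have h : (fullMechanism u ε β).out (streamPrefix x t) ω =
      predAnswer (fun m => (prefixEst (fun i => (streamPrefix x t).getD i .idle) ω
        (streamPrefix x t).length m : ℝ)) (prefixErr u ε β (streamPrefix x t).length) := rfl
  rw [h, length_streamPrefix]
  refine predAnswer_congr fun m _ => ?_
  rw [prefixEst_congr (y := x) fun s hs => getD_streamPrefix x _ hs]

theorem fullMechanism_isDP (u : ℕ) {ε : ℝ} (β : ℝ) (hε : 0 < ε) :
    (fullMechanism u ε β).IsDP ε := by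
  intro x y hxy T S
  let c : Counter → ℤ := fun n => counterVal x n - counterVal y n
  have htr : ∀ (z z' : ℕ → FullUpdate u) (ω ω' : Counter → ℤ),
      (∀ n ∈ activeCounters u T, counterVal z n + ω n = counterVal z' n + ω' n) →
      (fullMechanism u ε β).transcript z T ω = (fullMechanism u ε β).transcript z' T ω' := by
    intro z z' ω ω' h
    funext i
    simp only [PredMechanism.transcript, fullMechanism_out]
    exact predAnswer_congr fun m hm => by rw [prefixEst_shift (Nat.succ_le_of_lt i.2) hm h]
  have hdep : ∀ z : ℕ → FullUpdate u, DependsOn (fun ω : Counter → ℤ =>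
      (fullMechanism u ε β).transcript z T ω) (activeCounters u T : Set Counter) :=
    fun z ω ω' h => htr z z ω ω' fun n hn => by rw [h n hn]
  have hshift : ∀ ω : Counter → ℤ, (fullMechanism u ε β).transcript x T ω =
      (fullMechanism u ε β).transcript y T (ω + c) := by
    intro ω
    refine htr x y ω (ω + c) fun n _ => ?_
    simp only [Pi.add_apply, c]
    ring
  exact lapNoise_shift (counterRate_pos u hε) (activeCounters u T) (hdep x) (hdep y)
    (fun g => ⟨c, sum_counterRate_mul_le hxy hε T, fun ω hω => (hshift ω).symm.trans hω⟩) S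

theorem minRate_pos (u : ℕ) {ε : ℝ} (hε : 0 < ε) (t : ℕ) : 0 < minRate u ε t := by
  have := levels_pos u
  unfold minRate; positivity

theorem prefixErr_nonneg (u : ℕ) {ε : ℝ} (hε : 0 < ε) (β : ℝ) (t : ℕ) : 0 ≤ prefixErr u ε β t := by
  have := minRate_pos u hε t
  unfold prefixErr; positivity

theorem prefixErr_mono {u : ℕ} (hu : 1 ≤ u) {ε β : ℝ} (hε : 0 < ε) (hβ : 0 < β) (hβ1 : β < 1) :
    Monotone (prefixErr u ε β) := by
  intro s t hst
  have hI : (1 : ℝ) ≤ u := by exact_mod_cast hu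
  have h0 := (logFail_pos hI hβ1 hβ s).le
  have h1 := logFail_mono hI hβ1 hβ hst
  have hlog : Nat.log 2 (s + 1) ≤ Nat.log 2 (t + 1) := Nat.log_mono_right (by omega)
  have hL := levels_pos u
  have h2 : minRate u ε t ≤ minRate u ε s := by unfold minRate; gcongr
  have h3 : maxCounters u s ≤ maxCounters u t := by unfold maxCounters; gcongr
  have h4 : 0 ≤ maxCounters u s := by unfold maxCounters; positivity
  have h5 := minRate_pos u hε t
  have h6 : 0 ≤ maxCounters u t + logFail u β t := by linarith
  unfold prefixErr
  gcongr

theorem fullMechanism_solves {u : ℕ} (hu : 1 ≤ u) {ε β : ℝ} (hε : 0 < ε) (hβ : 0 < β)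
    (hβ1 : β < 1) :
    (fullMechanism u ε β).Solves FullUpdate.step (fun t => 4 * prefixErr u ε β t + 1) β := by
  intro x
  have hI : (1 : ℝ) ≤ u := by exact_mod_cast hu
  let S : ℕ → ℕ → Finset Counter := fun t m => timeNodes (t + 1) ×ˢ oddNodes (levels u) m
  refine one_sub_le_of_bad (I := Fin u) (P := lapNoise (counterRate u ε))
    (bad := fun t i => {ω | prefixErr u ε β t ≤ |∑ n ∈ S t (i + 1), (ω n : ℝ)|}) hβ
    (fun t i => ?_) fun ω hω t _ q => ?_
  · rw [Fintype.card_fin, ← two_mul_exp_neg_logFail hI hβ1 hβ]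
    refine lapNoise_sum_tail (counterRate_pos u hε) _ (minRate_pos u hε t) ?_ ?_
      (logFail_pos hI hβ1 hβ t)
    · intro n hn
      have h1 := mem_timeNodes (Finset.mem_product.mp hn).1
      have h2 : n.1.1 + Nat.log 2 n.1.2 ≤ Nat.log 2 (t + 1) := by
        rw [log_node (τ := n.1.2 * 2 ^ n.1.1) h1.1 (Nat.mul_div_cancel _ (by positivity))]
        refine Nat.log_mono_right (le_trans ?_ h1.2)
        gcongr; omega
      have := levels_pos u
      have h3 : ((n.1.1 + Nat.log 2 n.1.2 : ℕ) : ℝ) ≤ (Nat.log 2 (t + 1) : ℕ) := by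
        exact_mod_cast h2
      unfold minRate counterRate
      gcongr
    · have h1 := card_timeNodes_le (t + 1)
      have h2 := card_oddNodes_le (levels u) (i + 1)
      have h3 : (S t (i + 1)).card ≤ 2 * levels u * (Nat.log 2 (t + 1) + 1) := by
        rw [Finset.card_product]
        calc _ ≤ 2 * Nat.log 2 (t + 1) * levels u := Nat.mul_le_mul h1 h2
          _ ≤ _ := by nlinarith
      unfold maxCounters
      exact_mod_cast h3
  · rw [fullMechanism_out]
    refine isRelaxedPred_predAnswer _ _ (prefixErr_nonneg u hε β t) (fun m hm => ?_) q
    rw [prefixEst_eq x ω t hm]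
    push_cast
    rw [add_sub_cancel_left]
    rcases Nat.eq_zero_or_pos m with rfl | hm0
    · have h0 : oddNodes (levels u) 0 = ∅ := by simp [oddNodes]
      rw [h0, Finset.product_empty, Finset.sum_empty, abs_zero]
      exact prefixErr_nonneg u hε β t
    · have h1 := hω t ⟨m - 1, by omega⟩
      simp only [Set.mem_ofPred_eq, not_le, S] at h1
      rw [Nat.sub_add_cancel hm0] at h1
      exact h1.le

/-! ### Asymptotics of the fully dynamic error -/

theorem half_le_log {n : ℕ} (hn : 2 ≤ n) : 1 / 2 ≤ Real.log n := by
  have h : Real.log 2 ≤ Real.log n := Real.log_le_log (by norm_num) (by exact_mod_cast hn)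
  linarith [Real.log_two_gt_d9]

theorem natLog_add_one_le {n : ℕ} (hn : 2 ≤ n) : (Nat.log 2 n : ℝ) + 1 ≤ 3 * Real.log n := by
  have h0 : (2 : ℝ) ^ Nat.log 2 n ≤ n := by exact_mod_cast Nat.pow_log_le_self 2 (by omega)
  have h1 := Real.log_le_log (by positivity) h0
  rw [Real.log_pow] at h1
  have h2 : Real.log 2 ≤ Real.log n := Real.log_le_log (by norm_num) (by exact_mod_cast hn)
  nlinarith [Real.log_two_gt_d9]

theorem log_mul_div {u t : ℕ} (hu : 2 ≤ u) (ht : 2 ≤ t) {β : ℝ} (hβ : 0 < β) :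
    Real.log (u * t / β) = Real.log u + Real.log t + Real.log (1 / β) := by
  have h1 : (u : ℝ) ≠ 0 := by positivity
  have h2 : (t : ℝ) ≠ 0 := by positivity
  rw [Real.log_div (by positivity) hβ.ne', Real.log_mul h1 h2, one_div, Real.log_inv]
  ring

theorem logFail_le {I : ℝ} (hI : 0 < I) {t : ℕ} (ht : 2 ≤ t) {β : ℝ} (hβ : 0 < β) :
    logFail I β t ≤ Real.log I + 5 * Real.log t + Real.log (1 / β) := by
  have h2 : (t : ℝ) ≠ 0 := by positivity
  have h3 : (2 : ℝ) ≤ t := by exact_mod_cast ht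
  have h4 : 2 * ((t + 1) * (t + 2)) ≤ (t : ℝ) ^ 5 := by
    have h5 : (t : ℝ) + 1 ≤ 3 / 2 * t := by linarith
    have h6 : (t : ℝ) + 2 ≤ 2 * t := by linarith
    have h7 : (8 : ℝ) ≤ (t : ℝ) ^ 3 := by
      calc (8 : ℝ) = 2 ^ 3 := by norm_num
        _ ≤ _ := by gcongr
    calc 2 * (((t : ℝ) + 1) * (t + 2)) ≤ 2 * ((3 / 2 * t) * (2 * t)) := by gcongr
      _ = 6 * (t : ℝ) ^ 2 := by ring
      _ ≤ (t : ℝ) ^ 3 * t ^ 2 := by gcongr; linarith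
      _ = _ := by ring
  have h5 : 2 * I * ((t + 1) * (t + 2)) / β ≤ I * t ^ 5 * (1 / β) := by
    rw [mul_one_div]
    refine div_le_div_of_nonneg_right ?_ hβ.le
    calc 2 * I * ((t + 1) * (t + 2)) = I * (2 * ((t + 1) * (t + 2))) := by ring
      _ ≤ _ := by gcongr
  refine (Real.log_le_log (by positivity) h5).trans (le_of_eq ?_)
  rw [Real.log_mul (by positivity) (by positivity), Real.log_mul hI.ne' (by positivity),
    Real.log_pow]
  norm_num

/-- Here the number of counters dominates the logarithm of the failure probability, so that the sum
of their noise concentrates as a Gaussian variable does. -/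
theorem fullMechanism_asymptotics (ε₀ K : ℝ) : ∃ C : ℝ, ∀ (u : ℕ) (ε β : ℝ) (t : ℕ),
    2 ≤ u → 0 < ε → ε ≤ ε₀ → 0 < β → β < 1 → 2 ≤ t →
    Real.log (1 / β) ≤ K * (Real.log u * Real.log t) →
    4 * prefixErr u ε β t + 1 ≤
      C * (ε⁻¹ * (Real.log u * Real.log t) ^ (3 / 2 : ℝ) * √(Real.log (u * t / β))) := by
  set C₁ := √(5 * (56 + 5 * |K|)) with hC₁
  refine ⟨4 * (216 * C₁) + 8 * ε₀, fun u ε β t hu hε hε₀ hβ hβ1 ht hK => ?_⟩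
  have hI : (1 : ℝ) ≤ u := by exact_mod_cast (by omega : 1 ≤ u)
  have ha := half_le_log hu
  have hb := half_le_log ht
  have hcd := log_mul_div hu ht hβ
  have hl := logFail_le (lt_of_lt_of_le one_pos hI) ht hβ
  have hl0 := logFail_pos hI hβ1 hβ t
  have hd : 0 < Real.log (1 / β) := Real.log_pos (by rwa [lt_div_iff₀ hβ, one_mul])
  have hlev : (levels u : ℝ) ≤ 3 * Real.log u := by
    have := natLog_add_one_le hu
    unfold levels; push_cast; exact this
  have htime : ((Nat.log 2 (t + 1) : ℕ) : ℝ) + 1 ≤ 6 * Real.log t := by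
    refine (natLog_add_one_le (n := t + 1) (by omega)).trans ?_
    have h1 : ((t + 1 : ℕ) : ℝ) ≤ (t : ℝ) ^ 2 := by
      have : (2 : ℝ) ≤ t := by exact_mod_cast ht
      push_cast
      nlinarith
    have h2 := Real.log_le_log (by positivity) h1
    rw [Real.log_pow] at h2
    push_cast at h2 ⊢
    linarith
  set a := Real.log u
  set b := Real.log t
  set c := Real.log (u * t / β)
  have hL := levels_pos u
  have hprod : (levels u : ℝ) * ((Nat.log 2 (t + 1) : ℕ) + 1) ≤ 18 * (a * b) := by
    calc _ ≤ (3 * a) * (6 * b) := by gcongr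
      _ = _ := by ring
  have hab : 1 / 4 ≤ a * b := by nlinarith
  have hrate : 3 / minRate u ε t ≤ 216 * (a * b) * ε⁻¹ := by
    have : 3 / minRate u ε t =
        12 * ((levels u : ℝ) * ((Nat.log 2 (t + 1) : ℕ) + 1)) * ε⁻¹ := by
      unfold minRate
      field_simp
      norm_num
    rw [this]
    exact mul_le_mul_of_nonneg_right (by linarith) (inv_pos.mpr hε).le
  have hN : maxCounters u t ≤ 36 * (a * b) := by
    unfold maxCounters; linarith
  have hN0 : 0 ≤ maxCounters u t := by unfold maxCounters; positivity
  have hlc : logFail u β t ≤ 5 * c := by linarith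
  have hcab : c ≤ (4 + |K|) * (a * b) := by
    have h1 : K * (a * b) ≤ |K| * (a * b) := by gcongr; exact le_abs_self K
    nlinarith
  have hc1 : 1 ≤ c := by linarith
  have hK0 := abs_nonneg K
  have hsq : √((maxCounters u t + logFail u β t) * logFail u β t) ≤ C₁ * √(a * b) * √c := by
    rw [hC₁, ← Real.sqrt_mul (by positivity), ← Real.sqrt_mul (by positivity)]
    apply Real.sqrt_le_sqrt
    calc (maxCounters u t + logFail u β t) * logFail u β t
        ≤ (36 * (a * b) + 5 * ((4 + |K|) * (a * b))) * (5 * c) := by gcongr; linarith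
      _ = _ := by ring
  have hpow : (a * b) ^ (3 / 2 : ℝ) = a * b * √(a * b) := by
    rw [Real.sqrt_eq_rpow, ← Real.rpow_one_add' (by positivity) (by norm_num)]
    norm_num
  rw [hpow]
  have hE : prefixErr u ε β t ≤ 216 * C₁ * (ε⁻¹ * (a * b * √(a * b)) * √c) := by
    have : 0 < ε⁻¹ := by positivity
    calc prefixErr u ε β t ≤ 216 * (a * b) * ε⁻¹ * (C₁ * √(a * b) * √c) := by
          unfold prefixErr; gcongr
      _ = _ := by ring
  have h1 : 1 ≤ 8 * ε₀ * (ε⁻¹ * (a * b * √(a * b)) * √c) := by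
    have h2 : 1 / 2 ≤ √(a * b) := Real.le_sqrt_of_sq_le (by norm_num; linarith)
    have h3 : 1 ≤ √c := Real.one_le_sqrt.mpr hc1
    have h4 : 1 ≤ ε₀ * ε⁻¹ := by rw [← div_eq_mul_inv, one_le_div hε]; exact hε₀
    have h5 : 1 / 8 ≤ a * b * √(a * b) := by nlinarith
    have h6 : 1 / 8 ≤ a * b * √(a * b) * √c := by nlinarith
    calc (1 : ℝ) ≤ (ε₀ * ε⁻¹) * (8 * (a * b * √(a * b) * √c)) :=
          one_le_mul_of_one_le_of_one_le h4 (by linarith)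
      _ = _ := by ring
  linarith

/-! ### Adaptive splitting of the universe -/

/-- The nodes `v = (i, j)` of the binary tree over the universe; `v` stands for the elements `e`
with `e / 2 ^ i = j`, and the root is `(levels u, 0)`. Pairs which stand for no element are
included. -/
def treeNodes (u : ℕ) : Finset (ℕ × ℕ) := Finset.range (levels u + 1) ×ˢ Finset.range u

/-- `v` is the highest node on the path from the root to the leaf `e` which is not in the set `A` of
marked nodes. -/
def Hits (u : ℕ) (A : Finset (ℕ × ℕ)) (e : ℕ) (v : ℕ × ℕ) : Prop :=
  v.1 ≤ levels u ∧ v.2 = e / 2 ^ v.1 ∧ v ∉ A ∧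
    ∀ i, v.1 < i → i ≤ levels u → (i, e / 2 ^ i) ∈ A

theorem Hits.unique {u : ℕ} {A : Finset (ℕ × ℕ)} {e : ℕ} {v w : ℕ × ℕ} (hv : Hits u A e v)
    (hw : Hits u A e w) : v = w := by
  obtain ⟨v1, v2⟩ := v
  obtain ⟨w1, w2⟩ := w
  obtain ⟨a1, a2, a3, a4⟩ := hv
  obtain ⟨b1, b2, b3, b4⟩ := hw
  simp only at *
  subst a2 b2
  rcases lt_trichotomy v1 w1 with h | h | h
  · exact absurd (a4 w1 h b1) b3
  · rw [h]
  · exact absurd (b4 v1 h a1) a3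

theorem Hits.mem_treeNodes {u : ℕ} {A : Finset (ℕ × ℕ)} {e : Fin u} {v : ℕ × ℕ}
    (h : Hits u A e v) : v ∈ treeNodes u := by
  obtain ⟨h1, h2, -⟩ := h
  simp only [treeNodes, Finset.mem_product, Finset.mem_range]
  refine ⟨by omega, ?_⟩
  rw [h2]
  exact (Nat.div_le_self _ _).trans_lt e.2

theorem exists_hits (u : ℕ) {A : Finset (ℕ × ℕ)} {e : ℕ} (h : (0, e) ∉ A) : ∃ v, Hits u A e v := by
  classical
  let P : ℕ → Prop := fun i => (i, e / 2 ^ i) ∉ A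
  have h0 : P 0 := by simpa [P] using h
  refine ⟨(Nat.findGreatest P (levels u), e / 2 ^ Nat.findGreatest P (levels u)),
    Nat.findGreatest_le _, rfl, Nat.findGreatest_spec (P := P) (Nat.zero_le _) h0, fun i h1 h2 => ?_⟩
  exact not_not.mp (Nat.findGreatest_is_greatest h1 h2)

/-- The update `a` inserts an element which is counted at the node `v` if `A` is the set of marked
nodes. -/
def InsertsAt {u : ℕ} (A : Finset (ℕ × ℕ)) (a : InsertUpdate u) (v : ℕ × ℕ) : Prop :=
  ∃ e : Fin u, a = .insert e ∧ Hits u A e v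

theorem InsertsAt.unique {u : ℕ} {A : Finset (ℕ × ℕ)} {a : InsertUpdate u} {v w : ℕ × ℕ}
    (hv : InsertsAt A a v) (hw : InsertsAt A a w) : v = w := by
  obtain ⟨e, rfl, h1⟩ := hv
  obtain ⟨f, hf, h2⟩ := hw
  cases hf
  exact h1.unique h2

/-- The number of the insertions among the first `t` updates which are counted at `v` if `h s` is
the set of nodes marked by the first `s` updates. -/
noncomputable def nodeCount {u : ℕ} (x : ℕ → InsertUpdate u) (h : ℕ → Finset (ℕ × ℕ)) (v : ℕ × ℕ)
    (t : ℕ) : ℕ :=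
  open Classical in ((Finset.range t).filter fun s => InsertsAt (h s) (x s) v).card

theorem nodeCount_zero {u : ℕ} (x : ℕ → InsertUpdate u) (h : ℕ → Finset (ℕ × ℕ)) (v : ℕ × ℕ) :
    nodeCount x h v 0 = 0 := by
  simp [nodeCount]

open Classical in
theorem nodeCount_succ {u : ℕ} (x : ℕ → InsertUpdate u) (h : ℕ → Finset (ℕ × ℕ)) (v : ℕ × ℕ)
    (t : ℕ) :
    nodeCount x h v (t + 1) = nodeCount x h v t + if InsertsAt (h t) (x t) v then 1 else 0 := by
  rw [nodeCount, nodeCount, Finset.range_add_one, Finset.filter_insert]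
  split_ifs with h1
  · rw [Finset.card_insert_of_notMem (by simp)]
  · rfl

theorem nodeCount_congr {u : ℕ} {x y : ℕ → InsertUpdate u} {h h' : ℕ → Finset (ℕ × ℕ)} {t : ℕ}
    (hx : ∀ s < t, x s = y s) (hh : ∀ s < t, h s = h' s) (v : ℕ × ℕ) :
    nodeCount x h v t = nodeCount y h' v t := by
  classical
  unfold nodeCount
  congr 1
  refine Finset.filter_congr fun s hs => ?_
  rw [hx s (Finset.mem_range.mp hs), hh s (Finset.mem_range.mp hs)]

open Classical in
theorem nodeCount_le_of_neighboring {u : ℕ} {x y : ℕ → InsertUpdate u} {s : ℕ}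
    (hs : ∀ i, i ≠ s → x i = y i) (h : ℕ → Finset (ℕ × ℕ)) (v : ℕ × ℕ) (t : ℕ) :
    nodeCount y h v t ≤ nodeCount x h v t + if InsertsAt (h s) (y s) v then 1 else 0 := by
  have hsub : ((Finset.range t).filter fun i => InsertsAt (h i) (y i) v) ⊆
      ((Finset.range t).filter fun i => InsertsAt (h i) (x i) v) ∪
        if InsertsAt (h s) (y s) v then {s} else ∅ := by
    intro i hi
    rw [Finset.mem_filter] at hi
    rw [Finset.mem_union, Finset.mem_filter]
    by_cases his : i = s
    · subst his
      rw [if_pos hi.2]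
      exact Or.inr (Finset.mem_singleton_self _)
    · rw [hs i his]
      exact Or.inl hi
  refine (Finset.card_le_card hsub).trans ((Finset.card_union_le _ _).trans ?_)
  unfold nodeCount
  split_ifs <;> simp

/-- The noise: at each node one variable for the threshold, and one for the test at each time. -/
abbrev SplitNoise : Type := (ℕ × ℕ) × Option ℕ → ℤ

/-- The set of marked nodes and the counts at all nodes after `t` updates. The update of index `t`
is counted, and then each node is marked whose count plus noise reaches the noisy threshold. -/
noncomputable def splitState {u : ℕ} (thr : ℕ → ℝ) (x : ℕ → InsertUpdate u) (ω : SplitNoise) :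
    ℕ → Finset (ℕ × ℕ) × (ℕ × ℕ → ℕ)
  | 0 => (∅, fun _ => 0)
  | t + 1 =>
    open Classical in
    let A := (splitState thr x ω t).1
    let c : ℕ × ℕ → ℕ := fun v =>
      (splitState thr x ω t).2 v + if InsertsAt A (x t) v then 1 else 0
    (A ∪ (treeNodes u).filter fun v => thr t + ω (v, none) ≤ c v + ω (v, some t), c)

/-- The set of nodes marked by the first `t` updates. -/
noncomputable def marks {u : ℕ} (thr : ℕ → ℝ) (x : ℕ → InsertUpdate u) (ω : SplitNoise) (t : ℕ) :
    Finset (ℕ × ℕ) := (splitState thr x ω t).1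

theorem splitState_snd {u : ℕ} (thr : ℕ → ℝ) (x : ℕ → InsertUpdate u) (ω : SplitNoise) (t : ℕ)
    (v : ℕ × ℕ) : (splitState thr x ω t).2 v = nodeCount x (marks thr x ω) v t := by
  induction t with
  | zero => rw [nodeCount_zero]; rfl
  | succ t ih => rw [nodeCount_succ, ← ih]; rfl

theorem marks_zero {u : ℕ} (thr : ℕ → ℝ) (x : ℕ → InsertUpdate u) (ω : SplitNoise) :
    marks thr x ω 0 = ∅ := rfl

theorem mem_marks_succ {u : ℕ} (thr : ℕ → ℝ) (x : ℕ → InsertUpdate u) (ω : SplitNoise) (t : ℕ)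
    (v : ℕ × ℕ) : v ∈ marks thr x ω (t + 1) ↔ v ∈ marks thr x ω t ∨ v ∈ treeNodes u ∧
      thr t + ω (v, none) ≤ nodeCount x (marks thr x ω) v (t + 1) + ω (v, some t) := by
  rw [← splitState_snd, marks, splitState]
  simp only [Finset.mem_union, Finset.mem_filter]
  rfl

theorem marks_mono {u : ℕ} (thr : ℕ → ℝ) (x : ℕ → InsertUpdate u) (ω : SplitNoise) :
    Monotone (marks thr x ω) :=
  monotone_nat_of_le_succ fun t v hv => (mem_marks_succ thr x ω t v).mpr (Or.inl hv)

theorem marks_congr {u : ℕ} {thr : ℕ → ℝ} {x y : ℕ → InsertUpdate u} {ω ω' : SplitNoise} {t : ℕ}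
    (hx : ∀ s < t, x s = y s) (hn : ∀ v ∈ treeNodes u, ω (v, none) = ω' (v, none))
    (hs : ∀ v ∈ treeNodes u, ∀ s < t, ω (v, some s) = ω' (v, some s)) :
    marks thr x ω t = marks thr y ω' t := by
  induction t using Nat.strong_induction_on with
  | _ t ih =>
    cases t with
    | zero => rfl
    | succ t =>
      have h1 : ∀ s < t + 1, marks thr x ω s = marks thr y ω' s := fun s hst =>
        ih s hst (fun i hi => hx i (hi.trans hst)) fun v hv i hi => hs v hv i (hi.trans hst)
      ext v
      rw [mem_marks_succ, mem_marks_succ, h1 t (Nat.lt_succ_self t), nodeCount_congr hx h1]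
      by_cases hv : v ∈ treeNodes u
      · rw [hn v hv, hs v hv t (Nat.lt_succ_self t)]
      · simp [hv]

/-! ### Privacy of adaptive splitting -/

/-- The nodes at which the updates of index `s` of two streams are counted. -/
noncomputable def affected {u : ℕ} (x y : ℕ → InsertUpdate u) (h : ℕ → Finset (ℕ × ℕ)) (s : ℕ) :
    Finset (ℕ × ℕ) :=
  open Classical in
  (treeNodes u).filter (fun v => InsertsAt (h s) (x s) v) ∪
    (treeNodes u).filter fun v => InsertsAt (h s) (y s) v

theorem card_affected_le {u : ℕ} (x y : ℕ → InsertUpdate u) (h : ℕ → Finset (ℕ × ℕ)) (s : ℕ) :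
    (affected x y h s).card ≤ 2 := by
  classical
  have h1 : ∀ z : ℕ → InsertUpdate u,
      ((treeNodes u).filter fun v => InsertsAt (h s) (z s) v).card ≤ 1 := fun z =>
    Finset.card_le_one.mpr fun v hv w hw =>
      (Finset.mem_filter.mp hv).2.unique (Finset.mem_filter.mp hw).2
  have := Finset.card_union_le ((treeNodes u).filter fun v => InsertsAt (h s) (x s) v)
    ((treeNodes u).filter fun v => InsertsAt (h s) (y s) v)
  have := h1 x
  have := h1 y
  unfold affected
  omega

/-- The shift of the noise which makes up for the change of the update of index `s`, given that `h`
is the history of the sets of marked nodes: at the affected nodes the threshold is raised by `1`,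
and the test at which the node is marked by `2`. -/
noncomputable def splitShift {u : ℕ} (x y : ℕ → InsertUpdate u) (h : ℕ → Finset (ℕ × ℕ)) (s : ℕ) :
    SplitNoise :=
  fun n => if n.1 ∈ affected x y h s then
    (match n.2 with
      | none => 1
      | some t => if n.1 ∉ h t ∧ n.1 ∈ h (t + 1) then 2 else 0) else 0

/-- The shifted noise leads to the same history of marks on the other stream. Counts change by at
most one, and only at affected nodes. There the raised threshold keeps unsuccessful tests
unsuccessful, and adding `2` to the successful test outweighs both the raised threshold and a count
lowered by one. -/
theorem marks_shift {u : ℕ} {thr : ℕ → ℝ} {x y : ℕ → InsertUpdate u} {s : ℕ}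
    (hs : ∀ i, i ≠ s → x i = y i) {h : ℕ → Finset (ℕ × ℕ)} {T : ℕ} {ω : SplitNoise}
    (hω : ∀ t ≤ T, marks thr x ω t = h t) :
    ∀ t ≤ T, marks thr y (ω + splitShift x y h s) t = h t := by
  classical
  intro t
  induction t using Nat.strong_induction_on with
  | _ t ih =>
    intro ht
    cases t with
    | zero => rw [← hω 0 (Nat.zero_le _)]; rfl
    | succ t =>
      have h1 : ∀ i < t + 1, marks thr y (ω + splitShift x y h s) i = h i := fun i hi =>
        ih i hi (by omega)
      have h2 : ∀ i < t + 1, marks thr x ω i = h i := fun i hi => hω i (by omega)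
      ext v
      rw [mem_marks_succ, h1 t (by omega), nodeCount_congr (fun _ _ => rfl) h1]
      have hv := mem_marks_succ thr x ω t v
      rw [hω _ ht, h2 t (by omega), nodeCount_congr (fun _ _ => rfl) h2] at hv
      by_cases hvt : v ∈ h t
      · rw [hv]; simp [hvt]
      by_cases hvn : v ∈ treeNodes u
      swap
      · rw [hv]; simp [hvn]
      simp only [hvt, hvn, false_or, true_and] at hv ⊢
      have hyx := nodeCount_le_of_neighboring hs h v (t + 1)
      have hxy := nodeCount_le_of_neighboring (fun i hi => (hs i hi).symm) h v (t + 1)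
      by_cases hva : v ∈ affected x y h s
      · have hyx' : (nodeCount y h v (t + 1) : ℝ) ≤ nodeCount x h v (t + 1) + 1 := by
          have : nodeCount y h v (t + 1) ≤ nodeCount x h v (t + 1) + 1 :=
            hyx.trans (by split_ifs <;> omega)
          exact_mod_cast this
        have hxy' : (nodeCount x h v (t + 1) : ℝ) ≤ nodeCount y h v (t + 1) + 1 := by
          have : nodeCount x h v (t + 1) ≤ nodeCount y h v (t + 1) + 1 :=
            hxy.trans (by split_ifs <;> omega)
          exact_mod_cast this
        by_cases hm : v ∈ h (t + 1)
        · have := hv.mp hm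
          simp only [hm, iff_true, Pi.add_apply, splitShift, hva, if_true, hvt, not_false_eq_true,
            true_and]
          push_cast
          linarith
        · have := mt hv.mpr hm
          simp only [hm, iff_false, Pi.add_apply, splitShift, hva, if_true, hvt, and_false, if_false]
          push_cast
          linarith
      · have hna : ¬ InsertsAt (h s) (x s) v ∧ ¬ InsertsAt (h s) (y s) v := by
          simpa [affected, hvn] using hva
        rw [if_neg hna.2] at hyx
        rw [if_neg hna.1] at hxy
        have heq : nodeCount y h v (t + 1) = nodeCount x h v (t + 1) := by omega
        rw [hv, heq]
        simp [splitShift, hva]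

/-- The noise variables which matter up to time `T`. -/
def splitVars (u T : ℕ) : Finset ((ℕ × ℕ) × Option ℕ) :=
  treeNodes u ×ˢ Finset.insertNone (Finset.range T)

/-- At most two nodes are affected, and each is marked only once. -/
theorem sum_splitShift_le {u : ℕ} (x y : ℕ → InsertUpdate u) {h : ℕ → Finset (ℕ × ℕ)} (s T : ℕ)
    (hmono : ∀ t < T, h t ⊆ h (t + 1)) :
    ∑ n ∈ splitVars u T, |splitShift x y h s n| ≤ 6 := by
  classical
  have hnode : ∀ v : ℕ × ℕ, ∑ o ∈ Finset.insertNone (Finset.range T),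
      |splitShift x y h s (v, o)| ≤ if v ∈ affected x y h s then 3 else 0 := by
    intro v
    rw [Finset.sum_insertNone]
    split_ifs with hv
    · have h1 : ∀ t ∈ Finset.range T, |splitShift x y h s (v, some t)| =
          2 * (if v ∈ h (t + 1) then 1 else 0) - 2 * (if v ∈ h t then 1 else 0) := by
        intro t ht
        have h2 := @hmono t (Finset.mem_range.mp ht) v
        simp only [splitShift, hv, if_true]
        by_cases h3 : v ∈ h t
        · simp [h3, h2 h3]
        · by_cases h4 : v ∈ h (t + 1) <;> simp [h3, h4]
      rw [Finset.sum_congr rfl h1,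
        Finset.sum_range_sub (fun t => 2 * (if v ∈ h t then (1 : ℤ) else 0))]
      simp only [splitShift, hv, if_true]
      split_ifs <;> norm_num
    · simp [splitShift, hv]
  rw [splitVars, Finset.sum_product]
  refine (Finset.sum_le_sum fun v _ => hnode v).trans ?_
  rw [← Finset.sum_filter, Finset.sum_const, nsmul_eq_mul]
  have h1 : ((treeNodes u).filter fun v => v ∈ affected x y h s).card ≤ 2 :=
    (Finset.card_le_card fun v hv => (Finset.mem_filter.mp hv).2).trans (card_affected_le x y h s)
  have : ((((treeNodes u).filter fun v => v ∈ affected x y h s).card : ℕ) : ℤ) ≤ 2 := by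
    exact_mod_cast h1
  linarith

/-! ### The partially dynamic mechanism -/

/-- The answer to the query `q` given the set `A` of marked nodes: the largest left end of a marked
node which lies to the left of `q`. -/
noncomputable def markedAnswer {u : ℕ} (A : Finset (ℕ × ℕ)) (q : Fin u) : Option (Fin u) :=
  open Classical in
  if h : (Finset.univ.filter fun p : Fin u =>
      ∃ v ∈ A, p.val = v.2 * 2 ^ v.1 ∧ (v.2 + 1) * 2 ^ v.1 ≤ q + 1).Nonempty then
    some (Finset.max' _ h)
  else none

/-- The number of noise variables at one time, where those of the thresholds are counted at every
time. -/
noncomputable def splitVarsCard (u : ℕ) : ℝ := 2 * ((levels u + 1) * u)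

/-- A bound for the noise variables at time `t`: that of `lapNoise_sum_tail` for a single variable of
rate `ε / 6`. -/
noncomputable def splitErr (u : ℕ) (ε β : ℝ) (t : ℕ) : ℝ :=
  3 / (ε / 6) * √((1 + logFail (splitVarsCard u) β t) * logFail (splitVarsCard u) β t)

/-- The thresholds: large enough that a node without insertions is never marked. -/
noncomputable def splitThr (u : ℕ) (ε β : ℝ) (t : ℕ) : ℝ := 2 * splitErr u ε β t + 1

/-- The partially dynamic mechanism: the binary tree over the universe is explored adaptively, each
insertion being counted at the highest unmarked node above it, and a node is marked once its count
passes a noisy threshold. -/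
noncomputable def insertMechanism (u : ℕ) (ε β : ℝ) : PredMechanism (InsertUpdate u) u where
  Ω := SplitNoise
  mΩ := inferInstance
  P := lapNoise fun _ => ε / 6
  isProb := inferInstance
  out l ω := markedAnswer (marks (splitThr u ε β) (fun i => l.getD i .idle) ω l.length)
  measurable_out l S := by
    refine measurableSet_of_dependsOn (J := splitVars u l.length) (fun ω ω' h => ?_) S
    have h' : ∀ v ∈ treeNodes u, ∀ o ∈ Finset.insertNone (Finset.range l.length),
        ω (v, o) = ω' (v, o) := fun v hv o ho => h _ (Finset.mem_product.mpr ⟨hv, ho⟩)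
    have h1 := marks_congr (thr := splitThr u ε β) (x := fun i => l.getD i .idle)
      (ω := ω) (ω' := ω') (t := l.length) (fun _ _ => rfl) (fun v hv => h' v hv _ (by simp))
      fun v hv s hs => h' v hv _ (by simpa using hs)
    simp only [h1]

theorem insertMechanism_out {u : ℕ} (ε β : ℝ) (x : ℕ → InsertUpdate u) (t : ℕ) (ω : SplitNoise) :
    (insertMechanism u ε β).out (streamPrefix x t) ω =
      markedAnswer (marks (splitThr u ε β) x ω t) := by
  have h : (insertMechanism u ε β).out (streamPrefix x t) ω =
      markedAnswer (marks (splitThr u ε β) (fun i => (streamPrefix x t).getD i .idle) ω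
        (streamPrefix x t).length) := rfl
  rw [h, length_streamPrefix, marks_congr (y := x) (ω' := ω)
    (fun s hs => getD_streamPrefix x _ hs) (fun _ _ => rfl) fun _ _ _ _ => rfl]

theorem insertMechanism_isDP (u : ℕ) {ε : ℝ} (β : ℝ) (hε : 0 < ε) :
    (insertMechanism u ε β).IsDP ε := by
  intro x y hxy T S
  obtain ⟨s, hs⟩ := hxy
  let thr := splitThr u ε β
  let F : (ℕ → InsertUpdate u) → SplitNoise → Fin (T + 1) → Finset (ℕ × ℕ) :=
    fun z ω t => marks thr z ω t
  have hdep : ∀ z, DependsOn (F z) (splitVars u T : Set ((ℕ × ℕ) × Option ℕ)) := by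
    intro z ω ω' h
    have h' : ∀ v ∈ treeNodes u, ∀ o ∈ Finset.insertNone (Finset.range T),
        ω (v, o) = ω' (v, o) := fun v hv o ho => h _ (Finset.mem_product.mpr ⟨hv, ho⟩)
    funext t
    refine marks_congr (fun _ _ => rfl) (fun v hv => h' v hv _ (by simp)) fun v hv i hi =>
      h' v hv _ ?_
    have := t.2
    simp only [Finset.some_mem_insertNone, Finset.mem_range]
    omega
  have htr : ∀ z ω, (insertMechanism u ε β).transcript z T ω =
      fun i : Fin T => markedAnswer (F z ω i.succ) := by
    intro z ω
    funext i
    exact insertMechanism_out ε β z (i + 1) ω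
  let S' : Set (Fin (T + 1) → Finset (ℕ × ℕ)) :=
    {g | (fun i : Fin T => (markedAnswer (g i.succ) : Fin u → Option (Fin u))) ∈ S}
  have hset : ∀ z, {ω | (insertMechanism u ε β).transcript z T ω ∈ S} = F z ⁻¹' S' := by
    intro z
    ext ω
    rw [Set.mem_ofPred_eq, htr]
    rfl
  rw [hset x, hset y]
  refine lapNoise_shift (fun _ => by positivity) (splitVars u T) (hdep x) (hdep y) (fun g => ?_) S'
  -- Only histories which occur matter; these are monotone.
  by_cases hg : ∃ ω, F x ω = g
  swap
  · exact ⟨0, by simpa using hε.le, fun ω hω => absurd ⟨ω, hω⟩ hg⟩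
  obtain ⟨ω₀, hω₀⟩ := hg
  let h : ℕ → Finset (ℕ × ℕ) := marks thr x ω₀
  refine ⟨splitShift x y h s, ?_, fun ω hω => ?_⟩
  · have h1 := sum_splitShift_le x y (h := h) s T
      fun t _ => marks_mono thr x ω₀ (Nat.le_succ t)
    have h2 := (Int.cast_le (R := ℝ)).mpr h1
    rw [← Finset.mul_sum]
    push_cast at h2
    nlinarith
  · have h1 : ∀ t ≤ T, marks thr x ω t = h t := by
      intro t ht
      have := congrFun (hω.trans hω₀.symm) ⟨t, Nat.lt_succ_of_le ht⟩
      exact this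
    rw [← hω₀]
    funext t
    exact marks_shift hs h1 t (Nat.le_of_lt_succ t.2)

/-! ### Accuracy of adaptive splitting -/

theorem InsertUpdate.subset_step {u : ℕ} (D : Finset (Fin u)) (a : InsertUpdate u) :
    D ⊆ a.step D := by
  cases a <;> simp [step]

theorem mem_dataSet_insert {u : ℕ} {x : ℕ → InsertUpdate u} {t : ℕ} {e : Fin u} :
    e ∈ dataSet InsertUpdate.step x t ↔ ∃ s < t, x s = .insert e := by
  induction t with
  | zero => simp [dataSet]
  | succ t ih =>
    have h1 : e ∈ dataSet InsertUpdate.step x (t + 1) ↔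
        x t = .insert e ∨ e ∈ dataSet InsertUpdate.step x t := by
      rw [dataSet]
      cases x t <;> simp [InsertUpdate.step, eq_comm]
    rw [h1, ih]
    constructor
    · rintro (h | ⟨s, hs, h⟩)
      exacts [⟨t, by omega, h⟩, ⟨s, by omega, h⟩]
    · rintro ⟨s, hs, h⟩
      rcases Nat.lt_succ_iff_lt_or_eq.mp hs with h2 | rfl
      exacts [Or.inr ⟨s, h2, h⟩, Or.inl h]

/-- On small noise, a marked node contains an element of the data set. -/
theorem exists_mem_of_mem_marks {u : ℕ} {thr r : ℕ → ℝ} {x : ℕ → InsertUpdate u} {ω : SplitNoise}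
    (hthr : ∀ t, thr t = 2 * r t + 1) (hn : ∀ v ∈ treeNodes u, ∀ t, |(ω (v, none) : ℝ)| ≤ r t)
    (hs : ∀ v ∈ treeNodes u, ∀ t, |(ω (v, some t) : ℝ)| ≤ r t) {t : ℕ} {v : ℕ × ℕ}
    (hv : v ∈ marks thr x ω t) :
    ∃ e ∈ dataSet InsertUpdate.step x t, e.val / 2 ^ v.1 = v.2 := by
  classical
  induction t with
  | zero => simp [marks_zero] at hv
  | succ t ih =>
    rcases (mem_marks_succ thr x ω t v).mp hv with h | ⟨h1, h2⟩
    · obtain ⟨e, he, h3⟩ := ih h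
      exact ⟨e, InsertUpdate.subset_step _ _ he, h3⟩
    · have h3 := abs_le.mp (hn v h1 t)
      have h4 := abs_le.mp (hs v h1 t)
      have h5 : (0 : ℝ) < nodeCount x (marks thr x ω) v (t + 1) := by
        rw [hthr] at h2; linarith [h3.1, h4.2]
      have h6 : 0 < nodeCount x (marks thr x ω) v (t + 1) := by exact_mod_cast h5
      obtain ⟨s, hs⟩ := Finset.card_pos.mp h6
      obtain ⟨h7, e, he, hit⟩ := Finset.mem_filter.mp hs
      exact ⟨e, mem_dataSet_insert.mpr ⟨s, Finset.mem_range.mp h7, he⟩, hit.2.1.symm⟩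

/-- On small noise, no node has a large count: unmarked nodes are below the threshold, and marked
nodes do not count any further insertions. -/
theorem nodeCount_le {u : ℕ} {thr r : ℕ → ℝ} {x : ℕ → InsertUpdate u} {ω : SplitNoise}
    (hthr : ∀ t, thr t = 2 * r t + 1) (hr0 : ∀ t, 0 ≤ r t) (hr : Monotone r)
    (hn : ∀ v ∈ treeNodes u, ∀ t, |(ω (v, none) : ℝ)| ≤ r t)
    (hs : ∀ v ∈ treeNodes u, ∀ t, |(ω (v, some t) : ℝ)| ≤ r t) {v : ℕ × ℕ}
    (hv : v ∈ treeNodes u) (t : ℕ) :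
    (nodeCount x (marks thr x ω) v t : ℝ) ≤ 4 * r t + 2 ∧ (v ∉ marks thr x ω t →
      (nodeCount x (marks thr x ω) v t : ℝ) ≤ 4 * r t + 1) := by
  classical
  induction t with
  | zero =>
    rw [nodeCount_zero]
    have := hr0 0
    constructor
    · push_cast; linarith
    · intro; push_cast; linarith
  | succ t ih =>
    have h1 := hr (Nat.le_succ t)
    have h2 := nodeCount_succ x (marks thr x ω) v t
    constructor
    · by_cases hm : v ∈ marks thr x ω t
      · have h3 : ¬ InsertsAt (marks thr x ω t) (x t) v := fun ⟨e, _, he⟩ => he.2.2.1 hm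
        rw [if_neg h3, add_zero] at h2
        rw [h2]
        linarith [ih.1]
      · have h3 : (nodeCount x (marks thr x ω) v (t + 1) : ℝ) ≤
            nodeCount x (marks thr x ω) v t + 1 := by
          have : nodeCount x (marks thr x ω) v (t + 1) ≤ nodeCount x (marks thr x ω) v t + 1 := by
            rw [h2]; split_ifs <;> omega
          exact_mod_cast this
        linarith [ih.2 hm]
    · intro hm
      have h3 : ¬ (thr t + ω (v, none) ≤
          nodeCount x (marks thr x ω) v (t + 1) + ω (v, some t)) := fun h =>
        hm ((mem_marks_succ thr x ω t v).mpr (Or.inr ⟨hv, h⟩))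
      have h4 := abs_le.mp (hn v hv t)
      have h5 := abs_le.mp (hs v hv t)
      rw [hthr] at h3
      linarith [h4.2, h5.1]

/-- The children of the proper ancestors of the leaf `p`. -/
def pathChildren (u p : ℕ) : Finset (ℕ × ℕ) :=
  (Finset.range (levels u) ×ˢ Finset.range 2).image fun w => (w.1, 2 * (p / 2 ^ (w.1 + 1)) + w.2)

theorem card_pathChildren_le (u p : ℕ) : (pathChildren u p).card ≤ 2 * levels u := by
  refine Finset.card_image_le.trans ?_
  rw [Finset.card_product, Finset.card_range, Finset.card_range, mul_comm]

theorem mem_pathChildren {u p e i : ℕ} (hi : i < levels u) (h : e / 2 ^ (i + 1) = p / 2 ^ (i + 1)) :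
    (i, e / 2 ^ i) ∈ pathChildren u p := by
  refine Finset.mem_image.mpr ⟨(i, e / 2 ^ i % 2), ?_, ?_⟩
  · rw [Finset.mem_product, Finset.mem_range, Finset.mem_range]
    exact ⟨hi, Nat.mod_lt _ (by norm_num)⟩
  · simp only [Prod.mk.injEq, true_and]
    rw [← h, pow_succ, ← Nat.div_div_eq_div_mul]
    exact Nat.div_add_mod _ _

/-- If no marked node lies within `[a, q]`, then the elements of `[a, q]` were counted at few
nodes: the parent of such a node is marked, so that it contains `a - 1` or `q`. -/
theorem hits_mem_boundary {u : ℕ} {A : Finset (ℕ × ℕ)} {a q : ℕ}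
    (hno : ∀ v ∈ A, a ≤ v.2 * 2 ^ v.1 → q + 1 < (v.2 + 1) * 2 ^ v.1) {e : ℕ} (heu : e < u)
    (hae : a ≤ e) (heq : e ≤ q) {B : Finset (ℕ × ℕ)} (hBA : B ⊆ A) {v : ℕ × ℕ}
    (hv : Hits u B e v) :
    v ∈ insert (levels u, 0) (pathChildren u (a - 1) ∪ pathChildren u q) := by
  obtain ⟨i, j⟩ := v
  obtain ⟨h1, h2, -, h4⟩ := hv
  simp only at h1 h2 h4
  rw [Finset.mem_insert, Finset.mem_union]
  rcases h1.eq_or_lt with rfl | hi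
  · left
    rw [h2, Nat.div_eq_of_lt (heu.trans (lt_two_pow_levels u))]
  · right
    subst h2
    have hmem := hBA (h4 (i + 1) (Nat.lt_succ_self i) hi)
    have h5 := hno _ hmem
    simp only at h5
    have hp : 0 < 2 ^ (i + 1) := by positivity
    have h6 := Nat.div_mul_le_self e (2 ^ (i + 1))
    have h7 := Nat.lt_div_mul_add (a := e) hp
    rw [add_mul, one_mul] at h5
    -- The negation of `hc` implies `a ≠ 0`, so that the truncated `a - 1` is the predecessor of `a`.
    by_cases hc : a ≤ e / 2 ^ (i + 1) * 2 ^ (i + 1)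
    · refine Or.inr (mem_pathChildren hi ?_)
      symm
      rw [Nat.div_eq_iff hp]
      have := h5 hc
      omega
    · refine Or.inl (mem_pathChildren hi ?_)
      symm
      rw [Nat.div_eq_iff hp]
      omega

/-- If no marked node lies within `[a, q]`, then every element of `[a, q]` was counted at one of the
`4 * levels u + 1` boundary nodes. -/
theorem card_le_of_no_mark {u : ℕ} {thr : ℕ → ℝ} {x : ℕ → InsertUpdate u} {ω : SplitNoise} {t : ℕ}
    {b : ℝ} (hb0 : 0 ≤ b)
    (hb : ∀ v ∈ treeNodes u, (nodeCount x (marks thr x ω) v t : ℝ) ≤ b) {a q : ℕ}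
    (hno : ∀ v ∈ marks thr x ω t, a ≤ v.2 * 2 ^ v.1 → q + 1 < (v.2 + 1) * 2 ^ v.1)
    {R : Finset (Fin u)} (hR : ∀ e ∈ R, e ∈ dataSet InsertUpdate.step x t ∧ a ≤ e.val ∧ e.val ≤ q) :
    (R.card : ℝ) ≤ (4 * levels u + 1) * b := by
  classical
  let h := marks thr x ω
  let V := insert (levels u, 0) (pathChildren u (a - 1) ∪ pathChildren u q)
  let N : ℕ × ℕ → Finset ℕ := fun v => (Finset.range t).filter fun s => InsertsAt (h s) (x s) v
  have hsub : R.image InsertUpdate.insert ⊆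
      (V ∩ treeNodes u).biUnion fun v => (N v).image fun s => x s := by
    intro y hy
    obtain ⟨e, he, rfl⟩ := Finset.mem_image.mp hy
    obtain ⟨he1, he2, he3⟩ := hR e he
    obtain ⟨s, hs, hx⟩ := mem_dataSet_insert.mp he1
    have hsub : h s ⊆ h t := marks_mono thr x ω hs.le
    -- A marked leaf `e` would itself be a marked node within `[a, q]`.
    have hleaf : (0, e.val) ∉ h s := by
      intro hmem
      have := hno _ (hsub hmem) (by simpa using he2)
      simp only [pow_zero, mul_one] at this
      omega
    obtain ⟨v, hv⟩ := exists_hits u hleaf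
    refine Finset.mem_biUnion.mpr ⟨v, Finset.mem_inter.mpr
      ⟨hits_mem_boundary hno e.2 he2 he3 hsub hv, hv.mem_treeNodes⟩,
      Finset.mem_image.mpr ⟨s, ?_, hx⟩⟩
    exact Finset.mem_filter.mpr ⟨Finset.mem_range.mpr hs, e, hx, hv⟩
  have hinj : Function.Injective (InsertUpdate.insert : Fin u → InsertUpdate u) :=
    fun _ _ h => InsertUpdate.insert.inj h
  have hV : V.card ≤ 4 * levels u + 1 := by
    have h1 := Finset.card_insert_le (levels u, 0) (pathChildren u (a - 1) ∪ pathChildren u q)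
    have h2 := Finset.card_union_le (pathChildren u (a - 1)) (pathChildren u q)
    have h3 := card_pathChildren_le u (a - 1)
    have h4 := card_pathChildren_le u q
    simp only [V]
    omega
  have h1 : R.card ≤ ∑ v ∈ V ∩ treeNodes u, (N v).card := by
    rw [← Finset.card_image_of_injective R hinj]
    refine (Finset.card_le_card hsub).trans (Finset.card_biUnion_le.trans ?_)
    exact Finset.sum_le_sum fun v _ => Finset.card_image_le
  calc (R.card : ℝ) ≤ ∑ v ∈ V ∩ treeNodes u, ((N v).card : ℝ) := by exact_mod_cast h1
    _ ≤ ∑ v ∈ V ∩ treeNodes u, b := Finset.sum_le_sum fun v hv => by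
        have := hb v (Finset.mem_inter.mp hv).2
        unfold nodeCount at this
        convert this
    _ = ((V ∩ treeNodes u).card : ℝ) * b := by rw [Finset.sum_const, nsmul_eq_mul]
    _ ≤ (4 * levels u + 1) * b := by
        refine mul_le_mul_of_nonneg_right ?_ hb0
        exact_mod_cast (Finset.card_le_card Finset.inter_subset_left).trans hV

theorem isRelaxedPred_markedAnswer {u : ℕ} {thr : ℕ → ℝ} {x : ℕ → InsertUpdate u} {ω : SplitNoise}
    {t : ℕ} {b : ℝ} (hb0 : 0 ≤ b)
    (hb : ∀ v ∈ treeNodes u, (nodeCount x (marks thr x ω) v t : ℝ) ≤ b)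
    (hmark : ∀ v ∈ marks thr x ω t,
      ∃ e ∈ dataSet InsertUpdate.step x t, e.val / 2 ^ v.1 = v.2) (q : Fin u) :
    IsRelaxedPred (dataSet InsertUpdate.step x t) ((4 * levels u + 1) * b + 1) q
      (markedAnswer (marks thr x ω t) q) := by
  classical
  rw [markedAnswer]
  split_ifs with h
  · have hmem := Finset.max'_mem _ h
    have hmax := fun p => Finset.le_max' (Finset.univ.filter fun p : Fin u =>
      ∃ v ∈ marks thr x ω t, p.val = v.2 * 2 ^ v.1 ∧ (v.2 + 1) * 2 ^ v.1 ≤ q + 1) p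
    set p := Finset.max' _ h
    obtain ⟨-, v, hv, h1, h2⟩ := Finset.mem_filter.mp hmem
    obtain ⟨e, he, hev⟩ := hmark v hv
    have hp : 0 < 2 ^ v.1 := by positivity
    rw [Nat.div_eq_iff hp] at hev
    rw [add_mul, one_mul] at h2
    have hpe : p ≤ e := Fin.le_def.mpr (by omega)
    have heq : e ≤ q := Fin.le_def.mpr (by omega)
    refine ⟨Finset.card_pos.mpr ⟨e, Finset.mem_inter.mpr ⟨he, Finset.mem_Icc.mpr ⟨hpe, heq⟩⟩⟩, ?_⟩
    have hle := card_le_of_no_mark (a := p.val + 1) (q := q.val) hb0 hb (fun w hw hle => ?_)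
      (R := dataSet InsertUpdate.step x t ∩ Finset.Ioc p q) (fun f hf => by
        simp only [Finset.mem_inter, Finset.mem_Ioc, Fin.le_def, Fin.lt_def] at hf
        exact ⟨hf.1, by omega, hf.2.2⟩)
    · have h2 : dataSet InsertUpdate.step x t ∩ Finset.Icc p q ⊆
          insert p (dataSet InsertUpdate.step x t ∩ Finset.Ioc p q) := by
        intro f hf
        simp only [Finset.mem_inter, Finset.mem_Icc, Finset.mem_insert, Finset.mem_Ioc] at hf ⊢
        rcases hf.2.1.eq_or_lt with h3 | h3
        · exact Or.inl h3.symm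
        · exact Or.inr ⟨hf.1, h3, hf.2.2⟩
      have h3 : ((dataSet InsertUpdate.step x t ∩ Finset.Icc p q).card : ℝ) ≤
          (dataSet InsertUpdate.step x t ∩ Finset.Ioc p q).card + 1 := by
        exact_mod_cast (Finset.card_le_card h2).trans (Finset.card_insert_le _ _)
      linarith
    · by_contra hcon
      have hlt : w.2 * 2 ^ w.1 < u := by
        have h3 : 0 < 2 ^ w.1 := by positivity
        have := q.2
        rw [add_mul, one_mul] at hcon
        omega
      have := hmax ⟨w.2 * 2 ^ w.1, hlt⟩ (by
        simp only [Finset.mem_filter, Finset.mem_univ, true_and]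
        exact ⟨w, hw, rfl, not_lt.mp hcon⟩)
      have h3 : w.2 * 2 ^ w.1 ≤ p.val := this
      omega
  · have hle := card_le_of_no_mark (a := 0) (q := q.val) hb0 hb (fun w hw _ => ?_)
      (R := dataSet InsertUpdate.step x t ∩ Finset.Iic q) (fun f hf => by
        simp only [Finset.mem_inter, Finset.mem_Iic, Fin.le_def] at hf
        exact ⟨hf.1, Nat.zero_le _, hf.2⟩)
    · change ((dataSet InsertUpdate.step x t ∩ Finset.Iic q).card : ℝ) ≤ _
      linarith
    · by_contra hcon
      have hlt : w.2 * 2 ^ w.1 < u := by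
        have h3 : 0 < 2 ^ w.1 := by positivity
        have := q.2
        rw [add_mul, one_mul] at hcon
        omega
      exact h ⟨⟨w.2 * 2 ^ w.1, hlt⟩, by
        simp only [Finset.mem_filter, Finset.mem_univ, true_and]
        exact ⟨w, hw, rfl, not_lt.mp hcon⟩⟩

/-- The error of the partially dynamic mechanism at time `t`. -/
noncomputable def insertErr (u : ℕ) (ε β : ℝ) (t : ℕ) : ℝ :=
  (4 * levels u + 1) * (4 * splitErr u ε β t + 2) + 1

theorem one_le_splitVarsCard {u : ℕ} (hu : 1 ≤ u) : 1 ≤ splitVarsCard u := by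
  have h1 : (1 : ℝ) ≤ u := by exact_mod_cast hu
  have := levels_pos u
  unfold splitVarsCard
  nlinarith

theorem splitErr_nonneg (u : ℕ) {ε : ℝ} (hε : 0 < ε) (β : ℝ) (t : ℕ) : 0 ≤ splitErr u ε β t := by
  unfold splitErr; positivity

theorem splitErr_mono {u : ℕ} (hu : 1 ≤ u) {ε β : ℝ} (hε : 0 < ε) (hβ : 0 < β) (hβ1 : β < 1) :
    Monotone (splitErr u ε β) := by
  intro s t hst
  have hI := one_le_splitVarsCard hu
  have h0 := logFail_pos hI hβ1 hβ s
  have h1 := logFail_mono hI hβ1 hβ hst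
  have h2 : 0 ≤ 1 + logFail (splitVarsCard u) β t := by linarith
  unfold splitErr
  gcongr

theorem insertErr_mono {u : ℕ} (hu : 1 ≤ u) {ε β : ℝ} (hε : 0 < ε) (hβ : 0 < β) (hβ1 : β < 1) :
    Monotone (insertErr u ε β) := by
  intro s t hst
  have := splitErr_mono hu hε hβ hβ1 hst
  unfold insertErr
  gcongr

theorem insertMechanism_solves {u : ℕ} (hu : 1 ≤ u) {ε β : ℝ} (hε : 0 < ε) (hβ : 0 < β)
    (hβ1 : β < 1) :
    (insertMechanism u ε β).Solves InsertUpdate.step (insertErr u ε β) β := by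
  intro x
  have hI := one_le_splitVarsCard hu
  -- The threshold variables of all nodes are bounded anew at every time.
  let n : ℕ → treeNodes u × Bool → (ℕ × ℕ) × Option ℕ :=
    fun t i => (i.1.1, if i.2 then some t else none)
  have hcard : (Fintype.card (treeNodes u × Bool) : ℝ) = splitVarsCard u := by
    rw [Fintype.card_prod, Fintype.card_coe, Fintype.card_bool, treeNodes, Finset.card_product,
      Finset.card_range, Finset.card_range, splitVarsCard]
    push_cast
    ring
  refine one_sub_le_of_bad (I := treeNodes u × Bool)
    (P := lapNoise fun _ : (ℕ × ℕ) × Option ℕ => ε / 6)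
    (bad := fun t i => {ω | splitErr u ε β t ≤ |∑ m ∈ {n t i}, (ω m : ℝ)|}) hβ
    (fun t i => ?_) fun ω hω t _ q => ?_
  · rw [hcard, ← two_mul_exp_neg_logFail hI hβ1 hβ]
    exact lapNoise_sum_tail (fun _ => by positivity) _ (by positivity) (fun _ _ => le_rfl)
      (by simp) (logFail_pos hI hβ1 hβ t)
  · have hsome : ∀ v ∈ treeNodes u, ∀ t, |(ω (v, some t) : ℝ)| ≤ splitErr u ε β t := by
      intro v hv t
      have := hω t (⟨v, hv⟩, true)
      simp only [Set.mem_ofPred_eq, not_le, Finset.sum_singleton, n, if_true] at this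
      exact this.le
    have hnone : ∀ v ∈ treeNodes u, ∀ t, |(ω (v, none) : ℝ)| ≤ splitErr u ε β t := by
      intro v hv t
      have := hω t (⟨v, hv⟩, false)
      simp only [Set.mem_ofPred_eq, not_le, Finset.sum_singleton, n] at this
      exact this.le
    have h0 := splitErr_nonneg u hε β
    rw [insertMechanism_out]
    exact isRelaxedPred_markedAnswer (by linarith [h0 t])
      (fun v hv => (nodeCount_le (fun _ => rfl) h0 (splitErr_mono hu hε hβ hβ1) hnone hsome hv t).1)
      (fun v hv => exists_mem_of_mem_marks (fun _ => rfl) hnone hsome hv) q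

/-! ### Asymptotics of the partially dynamic error -/

/-- The error is of order `(1 + ε⁻¹) * log u * (log u + log t + log (1 / β))`, and `log t` is at most
`log u` up to a constant. The square root is only used to be bounded below. -/
theorem insertMechanism_asymptotics (A : ℝ) : ∃ C : ℝ, ∀ (u : ℕ) (ε β : ℝ) (t : ℕ),
    2 ≤ u → 0 < ε → 0 < β → β < 1 → 2 ≤ t → (t : ℝ) ≤ A * u →
    insertErr u ε β t ≤
      C * ((1 + ε⁻¹) * Real.log u * Real.log (u / β) * √(Real.log (t / β))) := by
  set A' := max A 1 with hA'
  have hA1 : 1 ≤ A' := le_max_right _ _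
  have hlA : 0 ≤ Real.log A' := Real.log_nonneg hA1
  set Q := 11 + 10 * Real.log A' with hQ
  refine ⟨2 * (14 * (72 * Q + 4) + 4), fun u ε β t hu hε hβ hβ1 ht hA => ?_⟩
  have hu0 : (0 : ℝ) < u := by positivity
  have hu2 : (2 : ℝ) ≤ u := by exact_mod_cast hu
  have ht0 : (0 : ℝ) < t := by positivity
  have hI := one_le_splitVarsCard (u := u) (by omega)
  have ha := half_le_log hu
  have hb := half_le_log ht
  have hd : 0 < Real.log (1 / β) := Real.log_pos (by rwa [lt_div_iff₀ hβ, one_mul])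
  have hdiv : ∀ z : ℝ, 0 < z → Real.log (z / β) = Real.log z + Real.log (1 / β) := by
    intro z hz
    rw [Real.log_div hz.ne' hβ.ne', one_div, Real.log_inv]
    ring
  have hlt : Real.log t ≤ Real.log A' + Real.log u := by
    rw [← Real.log_mul (by positivity) hu0.ne']
    refine Real.log_le_log ht0 (hA.trans ?_)
    gcongr
    exact le_max_left _ _
  have hlev : (levels u : ℝ) ≤ 3 * Real.log u := by
    have := natLog_add_one_le hu
    unfold levels; push_cast; exact this
  have hlevu : (levels u : ℝ) ≤ u := by
    have h1 : Nat.log 2 u < u := Nat.log_lt_self 2 (by omega)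
    exact_mod_cast h1
  have hlI : Real.log (splitVarsCard u) ≤ 4 * Real.log u := by
    have h1 : splitVarsCard u ≤ (u : ℝ) ^ 4 := by
      unfold splitVarsCard
      calc 2 * (((levels u : ℝ) + 1) * u) ≤ 2 * ((u + u) * u) := by gcongr; linarith
        _ = (2 * 2) * (u : ℝ) ^ 2 := by ring
        _ ≤ (u * u) * (u : ℝ) ^ 2 := by gcongr
        _ = _ := by ring
    have h2 := Real.log_le_log (by linarith) h1
    rw [Real.log_pow] at h2
    exact_mod_cast h2
  have hl := logFail_le (lt_of_lt_of_le one_pos hI) ht hβ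
  have hl0 := logFail_pos hI hβ1 hβ t
  rw [hdiv u hu0, hdiv t ht0]
  set a := Real.log u
  set d := Real.log (1 / β)
  set l := logFail (splitVarsCard u) β t
  have hlQ : 1 + l ≤ Q * (a + d) := by nlinarith
  have hsqrt : √((1 + l) * l) ≤ Q * (a + d) := by
    refine (Real.sqrt_le_iff.mpr ⟨by linarith, ?_⟩ : √((1 + l) * l) ≤ 1 + l).trans hlQ
    nlinarith
  have hE : splitErr u ε β t ≤ 18 * Q * (ε⁻¹ * (a + d)) := by
    have h1 : 3 / (ε / 6) = 18 * ε⁻¹ := by field_simp; norm_num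
    have h2 : 0 < ε⁻¹ := by positivity
    unfold splitErr
    rw [h1]
    calc _ ≤ 18 * ε⁻¹ * (Q * (a + d)) := by gcongr
      _ = _ := by ring
  have hX : insertErr u ε β t ≤ (14 * (72 * Q + 4) + 4) * ((1 + ε⁻¹) * a * (a + d)) := by
    have h1 : 0 < ε⁻¹ := by positivity
    have h2 := splitErr_nonneg u hε β t
    have h3 : 4 * (levels u : ℝ) + 1 ≤ 14 * a := by linarith
    have h4 : 4 * splitErr u ε β t + 2 ≤ (72 * Q + 4) * ((1 + ε⁻¹) * (a + d)) := by
      have h5 : 0 ≤ Q * (a + d) := by linarith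
      have h6 : 0 ≤ ε⁻¹ * (a + d) := by positivity
      nlinarith
    have h7 : 1 ≤ 4 * ((1 + ε⁻¹) * a * (a + d)) := by
      have h8 : 1 / 4 ≤ a * (a + d) := by nlinarith
      have h9 : 0 ≤ ε⁻¹ * (a * (a + d)) := by positivity
      nlinarith
    unfold insertErr
    calc _ ≤ 14 * a * ((72 * Q + 4) * ((1 + ε⁻¹) * (a + d))) +
          4 * ((1 + ε⁻¹) * a * (a + d)) := by gcongr
      _ = _ := by ring
  have hs : 1 / 2 ≤ √(Real.log t + d) := Real.le_sqrt_of_sq_le (by norm_num; linarith)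
  have hQ0 : 0 ≤ 14 * (72 * Q + 4) + 4 := by linarith
  have hpos : 0 ≤ (14 * (72 * Q + 4) + 4) * ((1 + ε⁻¹) * a * (a + d)) := by positivity
  calc insertErr u ε β t ≤ (14 * (72 * Q + 4) + 4) * ((1 + ε⁻¹) * a * (a + d)) := hX
    _ ≤ (14 * (72 * Q + 4) + 4) * ((1 + ε⁻¹) * a * (a + d)) * (2 * √(Real.log t + d)) :=
        le_mul_of_one_le_right hpos (by linarith)
    _ = _ := by ring

theorem mainTheorem2 :
    (∃ (M : ∀ u : ℕ, ℝ → ℝ → PredMechanism (FullUpdate u) u) (α : ℕ → ℝ → ℝ → ℕ → ℝ),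
      (∀ (u : ℕ) (ε β : ℝ), 1 ≤ u → 0 < ε → 0 < β → β < 1 →
        (M u ε β).IsDP ε ∧ Monotone (α u ε β) ∧
          (M u ε β).Solves FullUpdate.step (α u ε β) β) ∧
      ∀ ε₀ K : ℝ, ∃ C : ℝ, ∀ (u : ℕ) (ε β : ℝ) (t : ℕ),
        2 ≤ u → 0 < ε → ε ≤ ε₀ → 0 < β → β < 1 → 2 ≤ t →
        Real.log (1 / β) ≤ K * (Real.log u * Real.log t) →
        α u ε β t ≤
          C * (ε⁻¹ * (Real.log u * Real.log t) ^ (3 / 2 : ℝ) * √(Real.log (u * t / β)))) ∧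
    (∃ (M : ∀ u : ℕ, ℝ → ℝ → PredMechanism (InsertUpdate u) u) (α : ℕ → ℝ → ℝ → ℕ → ℝ),
      (∀ (u : ℕ) (ε β : ℝ), 1 ≤ u → 0 < ε → 0 < β → β < 1 →
        (M u ε β).IsDP ε ∧ Monotone (α u ε β) ∧
          (M u ε β).Solves InsertUpdate.step (α u ε β) β) ∧
      ∀ A : ℝ, ∃ C : ℝ, ∀ (u : ℕ) (ε β : ℝ) (t : ℕ),
        2 ≤ u → 0 < ε → 0 < β → β < 1 → 2 ≤ t → (t : ℝ) ≤ A * u →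
        α u ε β t ≤
          C * ((1 + ε⁻¹) * Real.log u * Real.log (u / β) * √(Real.log (t / β)))) := by
  refine ⟨⟨fullMechanism, fun u ε β t => 4 * prefixErr u ε β t + 1, fun u ε β hu hε hβ hβ1 =>
    ⟨fullMechanism_isDP u β hε, fun s t hst => ?_, fullMechanism_solves hu hε hβ hβ1⟩,
    fullMechanism_asymptotics⟩, ⟨insertMechanism, insertErr, fun u ε β hu hε hβ hβ1 =>
    ⟨insertMechanism_isDP u β hε, insertErr_mono hu hε hβ hβ1,
      insertMechanism_solves hu hε hβ hβ1⟩, insertMechanism_asymptotics⟩⟩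
  have := prefixErr_mono hu hε hβ hβ1 hst
  simp only
  linarith
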